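/- Let $G$ be a finite simple graph of order $n$. A set $D$ of vertices of $G$ is a locating-total dominating set if every vertex of $G$ has a neighbor in $D$ and any two distinct vertices $u,v\notin D$ satisfy $N(u)\cap D\neq N(v)\cap D$, where $N(\cdot)$ denotes the open neighborhood; $\gamma_t^L(G)$ is the minimum cardinality of such a set. The graph $G$ is twin-free if no two distinct vertices have the same open neighborhood or the same closed neighborhood. The 2-corona of a graph $H$ is obtained from $H$ by adding, for each vertex $v$ of $H$, a vertex-disjoint copy of a path $P_2$ and an edge joining $v$ to one end of that path. Suppose that $G$ is twin-free, has no isolated vertex, and contains no 4-cycle as a (not necessarily induced) subgraph. Then $\gamma_t^L(G)\le \frac{2}{3}n$. Further, if $G$ is connected, then $\gamma_t^L(G)=\frac{2}{3}n$ if and only if $G$ is isomorphic to a 6-cycle or to the 2-corona of some connected graph of order at least 2 that contains no 4-cycle. In general (for $G$ connected or not), $\gamma_t^L(G)=\frac{2}{3}n$ if and only if every connected component of $G$ is isomorphic to a 6-cycle or to the 2-corona of some connected graph of order at least 2 that contains no 4-cycle. -/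

import Mathlib

namespace LocTotDom

universe u

variable {V : Type u}

/-- `D` is a total dominating set: every vertex of `G` has a neighbor in `D`. -/
def IsTotalDominating (G : SimpleGraph V) (D : Set V) : Prop :=
  ∀ v : V, (G.neighborSet v ∩ D).Nonempty

/-- `D` is a locating set: any two distinct vertices outside `D` have distinct sets of
neighbors in `D`. -/
def IsLocating (G : SimpleGraph V) (D : Set V) : Prop :=
  ∀ u v : V, u ∉ D → v ∉ D → u ≠ v → G.neighborSet u ∩ D ≠ G.neighborSet v ∩ D

/-- `D` is a locating-total dominating set. -/
def IsLTD (G : SimpleGraph V) (D : Set V) : Prop :=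
  IsTotalDominating G D ∧ IsLocating G D

/-- The location-total domination number: the minimum cardinality of a locating-total
dominating set (for a finite graph without isolated vertices such a set exists, see
`exists_isLTD`, and the minimum is attained, see `exists_isLTD_card_eq`). -/
noncomputable def locTotDomNumber (G : SimpleGraph V) : ℕ :=
  sInf {k : ℕ | ∃ D : Finset V, IsLTD G (D : Set V) ∧ D.card = k}

/-- Open twins: `N(u) = N(v)`. -/
def IsOpenTwins (G : SimpleGraph V) (u v : V) : Prop :=
  u ≠ v ∧ G.neighborSet u = G.neighborSet v

/-- Closed twins: `N[u] = N[v]`. -/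
def IsClosedTwins (G : SimpleGraph V) (u v : V) : Prop :=
  u ≠ v ∧ insert u (G.neighborSet u) = insert v (G.neighborSet v)

/-- A graph is twin-free if it has neither open nor closed twins. -/
def IsTwinFree (G : SimpleGraph V) : Prop :=
  ∀ u v : V, ¬ IsOpenTwins G u v ∧ ¬ IsClosedTwins G u v

/-- No vertex of `G` is isolated. -/
def NoIsolated (G : SimpleGraph V) : Prop :=
  ∀ v : V, (G.neighborSet v).Nonempty

/-- `G` contains no 4-cycle as a (not necessarily induced) subgraph. -/
def NoFourCycle (G : SimpleGraph V) : Prop :=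
  (SimpleGraph.cycleGraph 4).Free G

/-- The 2-corona of `H`: to each vertex `w` of `H`, represented by `(w, 0)`, a path `P₂` on the
new vertices `(w, 1)`, `(w, 2)` is added, with `(w, 0)` joined to its end `(w, 1)`. -/
def twoCorona {W : Type u} (H : SimpleGraph W) : SimpleGraph (W × Fin 3) where
  Adj a b :=
    (a.2 = 0 ∧ b.2 = 0 ∧ H.Adj a.1 b.1) ∨
    (a.1 = b.1 ∧ ((a.2 = 0 ∧ b.2 = 1) ∨ (a.2 = 1 ∧ b.2 = 0) ∨
      (a.2 = 1 ∧ b.2 = 2) ∨ (a.2 = 2 ∧ b.2 = 1)))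
  symm := ⟨by
    rintro a b (⟨h1, h2, h3⟩ | ⟨h, h'⟩)
    · exact Or.inl ⟨h2, h1, h3.symm⟩
    · exact Or.inr ⟨h.symm, by tauto⟩⟩
  loopless := ⟨by
    rintro ⟨w, i⟩ (⟨_, _, h⟩ | ⟨_, h⟩)
    · exact H.loopless.irrefl w h
    · revert h
      fin_cases i <;> simp⟩

/-- `G` is isomorphic to a 6-cycle, or to the 2-corona of some connected graph of order at
least 2 that contains no 4-cycle. -/
def IsC6OrTwoCorona (G : SimpleGraph V) : Prop :=
  Nonempty (G ≃g SimpleGraph.cycleGraph 6) ∨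
    ∃ (W : Type u) (H : SimpleGraph W),
      H.Connected ∧ Nontrivial W ∧ NoFourCycle H ∧ Nonempty (G ≃g twoCorona H)

theorem exists_isLTD [Fintype V] {G : SimpleGraph V} (h : NoIsolated G) :
    ∃ D : Finset V, IsLTD G (D : Set V) :=
  ⟨Finset.univ, fun v => by simpa using h v, fun u _ hu => absurd (by simp) hu⟩

theorem exists_isLTD_card_eq [Fintype V] {G : SimpleGraph V} (h : NoIsolated G) :
    ∃ D : Finset V, IsLTD G (D : Set V) ∧ D.card = locTotDomNumber G := by
  obtain ⟨D, hD⟩ := exists_isLTD h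
  exact Nat.sInf_mem (s := {k : ℕ | ∃ D : Finset V, IsLTD G (D : Set V) ∧ D.card = k})
    ⟨D.card, D, hD, rfl⟩

end LocTotDom

/-!
Without 4-cycles two distinct vertices have at most one common neighbor. Hence a total dominating
set `D` is locating as soon as each member of `D` has at most one external private neighbor
(`IsSparseTD`, `IsSparseTD.isLTD`). Unlike being locating, this property survives the addition of
edges (`IsSparseTD.mono`), so it suffices to find such a set in some spanning subgraph of `G`.

Call a graph admissible if all components have order at least 3 and two leaves share a support
vertex only in a component `P₃`. Twin-free graphs without isolated vertices are admissible. Let `F`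
be an edge-minimal admissible spanning subgraph of `G`. Minimality forces every edge to have a
*critical* end (`isCriticalEnd_or_of_minimal`), so that the vertices of `F` are leaves, support
vertices, *connectors* (of degree 2, joining two support vertices of degree at least 3), and
vertices all of whose neighbors are support vertices of degree 2. All vertices except leaves and
connectors, together with one leaf at each support vertex whose neighbors are all leaves or
connectors, form a sparse total dominating set, and double counting shows that it has at most
two thirds of the vertices. A strictly smaller one exists unless `F` is a disjoint union of paths
`P₃` (`hasSmallSparseTD_or_of_minimal`).

In that remaining case take two vertices of each path, its middle and one end. If some path has
edges to other paths at its middle and at an end, or at both ends towards two different paths,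
then one vertex of that path or of an adjacent one can be saved (`HasP3Packing.small_of_middle_end`,
`HasP3Packing.small_of_ends`). Otherwise, as `G` is twin-free, middles have no edges to other
paths. If moreover each path has such edges at one end only, then a connected `G` is a 2-corona;
if not, then `G` consists of two paths forming a 6-cycle, and a chord of that cycle would again
save a vertex or create a 4-cycle.

Conversely, every total dominating set of a 6-cycle or of a 2-corona contains two thirds of the
vertices, and this bound is additive over components. A strict inequality in one component, together
with the upper bound on the union of the others, gives a strict inequality for `G`.
-/

namespace LocTotDom

open SimpleGraph

universe u

variable {V : Type u}

/-! ### Sparse total dominating sets -/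

/-- `u` is an external private neighbor of `d` with respect to `D`: it lies outside `D`, and `d`
is its only neighbor in `D`. -/
def IsExtPrivate (G : SimpleGraph V) (D : Set V) (d u : V) : Prop :=
  u ∉ D ∧ d ∈ D ∧ G.Adj u d ∧ ∀ e ∈ D, G.Adj u e → e = d

/-- A sparse total dominating set: a total dominating set each of whose members has at most one
external private neighbor. Without 4-cycles this is the same as being locating-total dominating,
but unlike the latter it survives the addition of edges. -/
def IsSparseTD (G : SimpleGraph V) (D : Set V) : Prop :=
  (∀ v, ∃ d ∈ D, G.Adj v d) ∧
    ∀ d u v, IsExtPrivate G D d u → IsExtPrivate G D d v → u = v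

/-- `G` has a sparse total dominating set on less than two thirds of its vertices. -/
def HasSmallSparseTD [Fintype V] (G : SimpleGraph V) : Prop :=
  ∃ D : Finset V, IsSparseTD G (D : Set V) ∧ 3 * D.card < 2 * Fintype.card V

theorem IsSparseTD.mono {F G : SimpleGraph V} (hFG : F ≤ G) {D : Set V} (h : IsSparseTD F D) :
    IsSparseTD G D := by
  have key : ∀ d u, IsExtPrivate G D d u → IsExtPrivate F D d u := by
    rintro d u ⟨hu, hd, _, hall⟩
    obtain ⟨e, he, hue⟩ := h.1 u
    obtain rfl := hall e he (hFG hue)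
    exact ⟨hu, hd, hue, fun e he h => hall e he (hFG h)⟩
  exact ⟨fun v => (h.1 v).imp fun d hd => ⟨hd.1, hFG hd.2⟩,
    fun d u v hu hv => h.2 d u v (key d u hu) (key d v hv)⟩

theorem HasSmallSparseTD.mono [Fintype V] {F G : SimpleGraph V} (hFG : F ≤ G)
    (h : HasSmallSparseTD F) : HasSmallSparseTD G := by
  obtain ⟨D, hD, hc⟩ := h
  exact ⟨D, hD.mono hFG, hc⟩

/-- A criterion for sparseness: choose a neighbor `g v ∈ D` for every `v ∉ D`, such that two
vertices with the same choice are not both external private neighbors. -/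
theorem isSparseTD_of_choice {G : SimpleGraph V} {D : Set V} (g : V → V)
    (htd : ∀ v, ∃ d ∈ D, G.Adj v d)
    (hg : ∀ v, v ∉ D → g v ∈ D ∧ G.Adj v (g v))
    (hinj : ∀ u v, u ∉ D → v ∉ D → g u = g v → u ≠ v →
      (∃ e ∈ D, G.Adj u e ∧ e ≠ g u) ∨ ∃ e ∈ D, G.Adj v e ∧ e ≠ g v) :
    IsSparseTD G D := by
  refine ⟨htd, ?_⟩
  rintro d u v ⟨hu, -, -, hu'⟩ ⟨hv, -, -, hv'⟩
  by_contra hne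
  have h1 := hu' _ (hg u hu).1 (hg u hu).2
  have h2 := hv' _ (hg v hv).1 (hg v hv).2
  rcases hinj u v hu hv (h1.trans h2.symm) hne with ⟨e, he, hue, hne⟩ | ⟨e, he, hue, hne⟩
  · exact hne ((hu' e he hue).trans h1.symm)
  · exact hne ((hv' e he hue).trans h2.symm)

/-! ### Graphs without 4-cycles and twin-free graphs -/

/-- Without 4-cycles, two distinct vertices have at most one common neighbor. -/
theorem NoFourCycle.eq_of_adj {G : SimpleGraph V} (h : NoFourCycle G) {a b c d : V}
    (hab : a ≠ b) (hac : G.Adj a c) (hbc : G.Adj b c) (had : G.Adj a d) (hbd : G.Adj b d) :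
    c = d := by
  by_contra hcd
  refine h ⟨⟨⟨![a, c, b, d], ?_⟩, ?_⟩⟩
  · intro i j hij
    rw [cycleGraph_adj] at hij
    fin_cases i <;> fin_cases j <;> first
      | (exfalso; revert hij; decide)
      | assumption
      | (apply SimpleGraph.Adj.symm; assumption)
  · have := hac.ne; have := hbc.ne; have := had.ne; have := hbd.ne
    intro i j hij
    fin_cases i <;> fin_cases j <;> simp_all

theorem noFourCycle_of_hom {W : Type*} {G : SimpleGraph V} {H : SimpleGraph W} (f : H →g G)
    (hf : Function.Injective f) (h : NoFourCycle G) : NoFourCycle H := by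
  rintro ⟨c⟩
  exact h ⟨⟨f.comp c.toHom, hf.comp c.injective'⟩⟩

/-- Two vertices outside `D` with the same neighbors in `D` have only one neighbor in `D`, since
`G` has no 4-cycle; so they are external private neighbors of the same vertex. -/
theorem IsSparseTD.isLTD {G : SimpleGraph V} (hC4 : NoFourCycle G) {D : Set V}
    (h : IsSparseTD G D) : IsLTD G D := by
  refine ⟨fun v => ?_, fun u v hu hv hne heq => ?_⟩
  · obtain ⟨d, hd, hvd⟩ := h.1 v
    exact ⟨d, hvd, hd⟩
  · have key : ∀ e ∈ D, (G.Adj u e ↔ G.Adj v e) := fun e he => by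
      have := Set.ext_iff.1 heq e
      simpa [he] using this
    obtain ⟨d, hd, hud⟩ := h.1 u
    have hvd := (key d hd).1 hud
    refine hne (h.2 d u v ⟨hu, hd, hud, fun e he hue => ?_⟩ ⟨hv, hd, hvd, fun e he hve => ?_⟩)
    · exact hC4.eq_of_adj hne hue ((key e he).1 hue) hud hvd
    · exact hC4.eq_of_adj hne ((key e he).2 hve) hve hud hvd

theorem IsTwinFree.open_eq {G : SimpleGraph V} (h : IsTwinFree G) {u v : V}
    (huv : ∀ w, G.Adj u w ↔ G.Adj v w) : u = v := by
  by_contra hne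
  exact (h u v).1 ⟨hne, Set.ext huv⟩

theorem IsTwinFree.closed_eq {G : SimpleGraph V} (h : IsTwinFree G) {u v : V}
    (huv : ∀ w, (w = u ∨ G.Adj u w) ↔ (w = v ∨ G.Adj v w)) : u = v := by
  by_contra hne
  exact (h u v).2 ⟨hne, Set.ext huv⟩

theorem isTwinFree_of_forall {G : SimpleGraph V}
    (h1 : ∀ u v, (∀ w, G.Adj u w ↔ G.Adj v w) → u = v)
    (h2 : ∀ u v, (∀ w, (w = u ∨ G.Adj u w) ↔ (w = v ∨ G.Adj v w)) → u = v) : IsTwinFree G :=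
  fun u v => ⟨fun h => h.1 (h1 u v (Set.ext_iff.1 h.2)), fun h => h.1 (h2 u v (Set.ext_iff.1 h.2))⟩

/-! ### Transport along isomorphisms and gluing -/

theorem IsTwinFree.of_iso {W : Type*} {G : SimpleGraph V} {H : SimpleGraph W} (e : H ≃g G)
    (h : IsTwinFree G) : IsTwinFree H := by
  refine isTwinFree_of_forall (fun u v huv => e.injective (h.open_eq fun w => ?_))
    (fun u v huv => e.injective (h.closed_eq fun w => ?_))
  · obtain ⟨w, rfl⟩ := e.surjective w
    rw [e.map_adj_iff, e.map_adj_iff]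
    exact huv w
  · obtain ⟨w, rfl⟩ := e.surjective w
    rw [e.map_adj_iff, e.map_adj_iff, e.injective.eq_iff, e.injective.eq_iff]
    exact huv w

theorem IsSparseTD.map_iso {W : Type*} {G : SimpleGraph V} {H : SimpleGraph W} (e : H ≃g G)
    {D : Finset W} (h : IsSparseTD H (D : Set W)) :
    IsSparseTD G (D.map e.toEquiv.toEmbedding : Finset V) := by
  have hmem : ∀ w, e w ∈ ((D.map e.toEquiv.toEmbedding : Finset V) : Set V) ↔ w ∈ (D : Set W) :=
    fun w => by simp
  refine ⟨fun v => ?_, fun d u v hu hv => ?_⟩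
  · obtain ⟨v, rfl⟩ := e.surjective v
    obtain ⟨d, hd, hvd⟩ := h.1 v
    exact ⟨e d, (hmem d).2 hd, e.map_adj_iff.2 hvd⟩
  · obtain ⟨v, rfl⟩ := e.surjective v
    obtain ⟨u, rfl⟩ := e.surjective u
    obtain ⟨d, rfl⟩ := e.surjective d
    have key : ∀ u, IsExtPrivate G (D.map e.toEquiv.toEmbedding : Finset V) (e d) (e u) →
        IsExtPrivate H (D : Set W) d u := by
      rintro u ⟨h1, h2, h3, h4⟩
      exact ⟨fun h => h1 ((hmem u).2 h), (hmem d).1 h2, e.map_adj_iff.1 h3, fun x hx hux =>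
        e.injective (h4 _ ((hmem x).2 hx) (e.map_adj_iff.2 hux))⟩
    exact congrArg e (h.2 d u v (key u hu) (key v hv))

theorem HasSmallSparseTD.of_iso {W : Type*} [Fintype V] [Fintype W] {G : SimpleGraph V}
    {H : SimpleGraph W} (e : H ≃g G) (h : HasSmallSparseTD H) : HasSmallSparseTD G := by
  obtain ⟨D, hD, hc⟩ := h
  refine ⟨_, hD.map_iso e, ?_⟩
  rw [Finset.card_map, ← Fintype.card_congr e.toEquiv]
  exact hc

/-- Sparse total dominating sets of the two sides of a vertex partition unite to one of the whole
graph. -/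
theorem exists_isSparseTD_union (G : SimpleGraph V) (A : Set V)
    {D₁ : Finset A} {D₂ : Finset (Aᶜ : Set V)} (h₁ : IsSparseTD (G.induce A) (D₁ : Set A))
    (h₂ : IsSparseTD (G.induce Aᶜ) (D₂ : Set (Aᶜ : Set V))) :
    ∃ D : Finset V, IsSparseTD G (D : Set V) ∧ D.card = D₁.card + D₂.card := by
  classical
  set D := (D₁.map (Function.Embedding.subtype _) ∪ D₂.map (Function.Embedding.subtype _) :
    Finset V) with hD
  have hm1 : ∀ a (ha : a ∈ A), a ∈ D ↔ (⟨a, ha⟩ : A) ∈ D₁ := by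
    intro a ha; simp [hD, ha]
  have hm2 : ∀ a (ha : a ∈ Aᶜ), a ∈ D ↔ (⟨a, ha⟩ : (Aᶜ : Set V)) ∈ D₂ := by
    intro a ha
    have : a ∉ A := ha
    simp [hD, this]
  refine ⟨D, ⟨fun v => ?_, ?_⟩, ?_⟩
  · by_cases hv : v ∈ A
    · obtain ⟨⟨d, hd⟩, h, h'⟩ := h₁.1 ⟨v, hv⟩
      exact ⟨d, (hm1 d hd).2 h, h'⟩
    · obtain ⟨⟨d, hd⟩, h, h'⟩ := h₂.1 ⟨v, hv⟩
      exact ⟨d, (hm2 d hd).2 h, h'⟩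
  · -- an external private neighbor lies on the same side as the vertex it is private to
    have key : ∀ d u, IsExtPrivate G D d u →
        (∃ (hd : d ∈ A) (hu : u ∈ A), IsExtPrivate (G.induce A) D₁ ⟨d, hd⟩ ⟨u, hu⟩) ∨
        (∃ (hd : d ∈ Aᶜ) (hu : u ∈ Aᶜ), IsExtPrivate (G.induce Aᶜ) D₂ ⟨d, hd⟩ ⟨u, hu⟩) := by
      rintro d u ⟨hu, hd, hud, hall⟩
      by_cases huA : u ∈ A
      · obtain ⟨⟨e, he⟩, heD, hue⟩ := h₁.1 ⟨u, huA⟩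
        obtain rfl := hall e ((hm1 e he).2 heD) hue
        refine Or.inl ⟨he, huA, fun h => hu ((hm1 u huA).2 h), heD, hue, ?_⟩
        rintro ⟨x, hx⟩ hxD hux
        exact Subtype.ext (hall x ((hm1 x hx).2 hxD) hux)
      · obtain ⟨⟨e, he⟩, heD, hue⟩ := h₂.1 ⟨u, huA⟩
        obtain rfl := hall e ((hm2 e he).2 heD) hue
        refine Or.inr ⟨he, huA, fun h => hu ((hm2 u huA).2 h), heD, hue, ?_⟩
        rintro ⟨x, hx⟩ hxD hux
        exact Subtype.ext (hall x ((hm2 x hx).2 hxD) hux)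
    intro d u v hu hv
    rcases key d u hu with ⟨hd, hu, h⟩ | ⟨hd, hu, h⟩ <;>
      rcases key d v hv with ⟨hd', hv, h'⟩ | ⟨hd', hv, h'⟩
    · exact congrArg Subtype.val (h₁.2 _ _ _ h h')
    · exact absurd hd hd'
    · exact absurd hd' hd
    · exact congrArg Subtype.val (h₂.2 _ _ _ h h')
  · rw [hD, Finset.card_union_of_disjoint, Finset.card_map, Finset.card_map]
    rw [Finset.disjoint_left]
    intro a ha hb
    simp only [Finset.mem_map, Function.Embedding.subtype_apply, Subtype.exists, exists_and_right,
      exists_eq_right] at ha hb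
    exact hb.1 ha.1

/-! ### Edge-minimal admissible spanning subgraphs -/

/-- `a` is a leaf, with support vertex `c`. -/
def IsLeafAt (F : SimpleGraph V) (a c : V) : Prop :=
  F.Adj a c ∧ ∀ d, F.Adj a d → d = c

/-- A graph is admissible if every component has order at least 3, and two leaves with the same
support vertex occur only in components that are paths `P₃`. -/
structure IsAdmissible (F : SimpleGraph V) : Prop where
  exists_adj : ∀ v, ∃ w, F.Adj v w
  not_leaf : ∀ u v, IsLeafAt F u v → ¬ IsLeafAt F v u
  eq_or_eq : ∀ a b c, a ≠ b → IsLeafAt F a c → IsLeafAt F b c → ∀ d, F.Adj c d → d = a ∨ d = b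

theorem isAdmissible_of_isTwinFree {G : SimpleGraph V} (htf : IsTwinFree G)
    (hiso : NoIsolated G) : IsAdmissible G := by
  refine ⟨hiso, fun u v huv hvu => ?_, fun a b c hab ha hb => ?_⟩
  · refine huv.1.ne (htf.closed_eq fun w => ?_)
    grind [IsLeafAt]
  · refine absurd (htf.open_eq fun w => ?_) hab
    grind [IsLeafAt]

/-- The neighborhood of `u` consists of the two distinct vertices `v` and `c`. -/
def HasTwoNeighbors (F : SimpleGraph V) (u v c : V) : Prop :=
  v ≠ c ∧ F.Adj u v ∧ F.Adj u c ∧ ∀ d, F.Adj u d → d = v ∨ d = c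

/-- A support vertex of degree at least 3. -/
def IsBigSupport (F : SimpleGraph V) (c : V) : Prop :=
  ∃ b s t, IsLeafAt F b c ∧ F.Adj c s ∧ F.Adj c t ∧ s ≠ b ∧ t ≠ b ∧ s ≠ t

theorem deleteEdges_singleton_adj (F : SimpleGraph V) (u v a b : V) :
    (F.deleteEdges {s(u, v)}).Adj a b ↔ F.Adj a b ∧ ¬ (a = u ∧ b = v ∨ a = v ∧ b = u) := by
  simp [deleteEdges_adj]

/-- A leaf created by deleting the edge `uv` is an end of this edge that had degree 2. -/
theorem isLeafAt_of_deleteEdges {F : SimpleGraph V} {u v p q : V} (huv : F.Adj u v)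
    (h : IsLeafAt (F.deleteEdges {s(u, v)}) p q) :
    IsLeafAt F p q ∨ (p = u ∧ HasTwoNeighbors F u v q) ∨ (p = v ∧ HasTwoNeighbors F v u q) := by
  obtain ⟨h1, h2⟩ := h
  rw [deleteEdges_singleton_adj] at h1
  simp only [deleteEdges_singleton_adj] at h2
  by_cases hu : p = u
  · subst hu
    refine Or.inr (Or.inl ⟨rfl, ?_, huv, h1.1, fun d hd => ?_⟩)
    · rintro rfl; exact h1.2 (Or.inl ⟨rfl, rfl⟩)
    · by_contra hcon
      exact hcon (Or.inr (h2 d ⟨hd, fun h => by have := huv.ne; grind⟩))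
  by_cases hv : p = v
  · subst hv
    refine Or.inr (Or.inr ⟨rfl, ?_, huv.symm, h1.1, fun d hd => ?_⟩)
    · rintro rfl; exact h1.2 (Or.inr ⟨rfl, rfl⟩)
    · by_contra hcon
      exact hcon (Or.inr (h2 d ⟨hd, fun h => by have := huv.ne; grind⟩))
  exact Or.inl ⟨h1.1, fun d hd => h2 d ⟨hd, fun h => h.elim (fun h => hu h.1) fun h => hv h.1⟩⟩

/-- In a triangle with two vertices `u`, `v` of degree 2, one of the edges at the third vertex
can be deleted. -/
theorem not_triangle_of_minimal {F : SimpleGraph V} (hF : Minimal IsAdmissible F) {u v c : V}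
    (hu : HasTwoNeighbors F u v c) (hv : HasTwoNeighbors F v u c) : False := by
  obtain ⟨hvc, huv, huc, hu⟩ := hu
  obtain ⟨-, -, hvc', hv⟩ := hv
  have hadj := deleteEdges_singleton_adj F u c
  have hvleaf : ∀ q, ¬ IsLeafAt F v q := fun q hq =>
    huc.ne ((hq.2 u huv.symm).trans (hq.2 c hvc').symm)
  have hcv : ∀ q, HasTwoNeighbors F c u q → q = v := fun q hq =>
    ((hq.2.2.2 v hvc'.symm).resolve_left huv.ne').symm
  have huq : ∀ q, HasTwoNeighbors F u c q → q = v := fun q hq =>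
    (hu q hq.2.2.1).resolve_right hq.1.symm
  have : IsAdmissible (F.deleteEdges {s(u, c)}) := by
    refine ⟨fun a => ?_, fun p q hp hq => ?_, fun p q r hpq hp hq d hd => ?_⟩
    · by_cases hau : a = u
      · exact ⟨v, (hadj _ _).2 ⟨hau ▸ huv, by have := huv.ne; grind⟩⟩
      by_cases hac : a = c
      · exact ⟨v, (hadj _ _).2 ⟨hac ▸ hvc'.symm, by have := huv.ne; grind⟩⟩
      obtain ⟨w, hw⟩ := hF.1.exists_adj a
      exact ⟨w, (hadj _ _).2 ⟨hw, by grind⟩⟩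
    · rcases isLeafAt_of_deleteEdges huc hp with hp' | ⟨rfl, hp'⟩ | ⟨rfl, hp'⟩
      · rcases isLeafAt_of_deleteEdges huc hq with hq' | ⟨rfl, hq'⟩ | ⟨rfl, hq'⟩
        · exact hF.1.not_leaf _ _ hp' hq'
        · exact hvleaf _ (huq _ hq' ▸ hp')
        · exact hvleaf _ (hcv _ hq' ▸ hp')
      · obtain rfl := huq _ hp'
        rcases isLeafAt_of_deleteEdges huc hq with hq' | ⟨h, hq'⟩ | ⟨h, hq'⟩
        · exact hvleaf _ hq'
        · exact huv.ne h.symm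
        · exact hvc h
      · obtain rfl := hcv _ hp'
        rcases isLeafAt_of_deleteEdges huc hq with hq' | ⟨h, hq'⟩ | ⟨h, hq'⟩
        · exact hvleaf _ hq'
        · exact huv.ne h.symm
        · exact hvc h
    · have key : r = v → d = p ∨ d = q := by
        rintro rfl
        have h1 := hv p ((hadj _ _).1 hp.1).1.symm
        have h2 := hv q ((hadj _ _).1 hq.1).1.symm
        have h3 := hv d ((hadj _ _).1 hd).1
        grind
      rcases isLeafAt_of_deleteEdges huc hp with hp' | ⟨rfl, hp'⟩ | ⟨rfl, hp'⟩
      · rcases isLeafAt_of_deleteEdges huc hq with hq' | ⟨rfl, hq'⟩ | ⟨rfl, hq'⟩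
        · exact hF.1.eq_or_eq _ _ _ hpq hp' hq' d ((hadj _ _).1 hd).1
        · exact key (huq _ hq')
        · exact key (hcv _ hq')
      · exact key (huq _ hp')
      · exact key (hcv _ hp')
  have hle := hF.2 this (deleteEdges_le _)
  exact ((hadj u c).1 (hle huc)).2 (Or.inl ⟨rfl, rfl⟩)

/-- What may go wrong at the end `u` of an edge `uv` when that edge is deleted from an
admissible graph: `u` becomes isolated, or lies in a component `K₂`, or becomes a second leaf at
its other neighbor. -/
def IsCriticalEnd (F : SimpleGraph V) (u v : V) : Prop :=
  IsLeafAt F u v ∨ (∃ b, HasTwoNeighbors F u v b ∧ IsLeafAt F b u) ∨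
    ∃ c, HasTwoNeighbors F u v c ∧ IsBigSupport F c

theorem isCriticalEnd_or_of_minimal {F : SimpleGraph V} (hF : Minimal IsAdmissible F) {u v : V}
    (huv : F.Adj u v) : IsCriticalEnd F u v ∨ IsCriticalEnd F v u := by
  by_contra hcon
  have hadj := deleteEdges_singleton_adj F u v
  have hlu : ∀ w, HasTwoNeighbors F u v w → ¬ IsLeafAt F w u :=
    fun w h h' => hcon (Or.inl (Or.inr (Or.inl ⟨w, h, h'⟩)))
  have hlv : ∀ w, HasTwoNeighbors F v u w → ¬ IsLeafAt F w v :=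
    fun w h h' => hcon (Or.inr (Or.inr (Or.inl ⟨w, h, h'⟩)))
  have : IsAdmissible (F.deleteEdges {s(u, v)}) := by
    refine ⟨fun a => ?_, fun p q hp hq => ?_, fun p q r hpq hp hq d hd => ?_⟩
    · by_contra hno
      simp only [hadj, not_exists, not_and, not_not] at hno
      obtain ⟨w, hw⟩ := hF.1.exists_adj a
      rcases hno w hw with ⟨rfl, rfl⟩ | ⟨rfl, rfl⟩
      · refine hcon (Or.inl (Or.inl ⟨huv, fun d hd => ?_⟩))
        have := hno d hd; have := huv.ne; grind
      · refine hcon (Or.inr (Or.inl ⟨hw, fun d hd => ?_⟩))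
        have := hno d hd; have := huv.ne; grind
    · rcases isLeafAt_of_deleteEdges huv hp with hp' | ⟨rfl, hp'⟩ | ⟨rfl, hp'⟩ <;>
        rcases isLeafAt_of_deleteEdges huv hq with hq' | ⟨h, hq'⟩ | ⟨h, hq'⟩
      · exact hF.1.not_leaf _ _ hp' hq'
      · subst h; exact hlu _ hq' hp'
      · subst h; exact hlv _ hq' hp'
      · exact hlu _ hp' hq'
      · exact hp'.2.2.1.ne h.symm
      · exact hp'.1 h.symm
      · exact hlv _ hp' hq'
      · exact hp'.1 h.symm
      · exact hp'.2.2.1.ne h.symm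
    · by_contra hd'
      push Not at hd'
      have hrd := ((hadj _ _).1 hd).1
      rcases isLeafAt_of_deleteEdges huv hp with hp' | ⟨rfl, hp'⟩ | ⟨rfl, hp'⟩ <;>
        rcases isLeafAt_of_deleteEdges huv hq with hq' | ⟨h, hq'⟩ | ⟨h, hq'⟩
      · exact (hF.1.eq_or_eq _ _ _ hpq hp' hq' d hrd).elim hd'.1 hd'.2
      · subst h
        exact hcon (Or.inl (Or.inr (Or.inr ⟨r, hq', p, q, d, hp', hq'.2.2.1.symm, hrd, hpq.symm,
          hd'.1, hd'.2.symm⟩)))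
      · subst h
        exact hcon (Or.inr (Or.inr (Or.inr ⟨r, hq', p, q, d, hp', hq'.2.2.1.symm, hrd, hpq.symm,
          hd'.1, hd'.2.symm⟩)))
      · exact hcon (Or.inl (Or.inr (Or.inr ⟨r, hp', q, p, d, hq', hp'.2.2.1.symm, hrd, hpq,
          hd'.2, hd'.1.symm⟩)))
      · exact hpq h.symm
      · exact not_triangle_of_minimal hF hp' hq'
      · exact hcon (Or.inr (Or.inr (Or.inr ⟨r, hp', q, p, d, hq', hp'.2.2.1.symm, hrd, hpq,
          hd'.2, hd'.1.symm⟩)))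
      · exact not_triangle_of_minimal hF hq' hp'
      · exact hpq h.symm
  have hle := hF.2 this (deleteEdges_le _)
  exact ((hadj u v).1 (hle huv)).2 (Or.inl ⟨rfl, rfl⟩)

/-! ### A sparse total dominating set of an edge-minimal admissible graph -/

/-- `a` has degree 1. -/
def IsLeaf (F : SimpleGraph V) (a : V) : Prop := ∃ c, IsLeafAt F a c

/-- `s` is the neighbor of a leaf. -/
def IsSupport (F : SimpleGraph V) (s : V) : Prop := ∃ a, IsLeafAt F a s

/-- A vertex of degree 2 whose neighbors are support vertices of degree at least 3. -/
def IsConnector (F : SimpleGraph V) (u : V) : Prop :=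
  ∃ v w, HasTwoNeighbors F u v w ∧ IsBigSupport F v ∧ IsBigSupport F w

/-- A support vertex of two leaves; in an admissible graph its component is a path `P₃`. -/
def IsP3Center (F : SimpleGraph V) (s : V) : Prop :=
  ∃ a b, a ≠ b ∧ IsLeafAt F a s ∧ IsLeafAt F b s

/-- A support vertex all of whose neighbors are leaves or connectors. -/
def IsNeedy (F : SimpleGraph V) (s : V) : Prop :=
  IsSupport F s ∧ ∀ d, F.Adj s d → IsLeaf F d ∨ IsConnector F d

section Structure

variable {F : SimpleGraph V}

theorem IsBigSupport.isSupport {c : V} (h : IsBigSupport F c) : IsSupport F c := by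
  obtain ⟨b, s, t, hb, -⟩ := h
  exact ⟨b, hb⟩

theorem IsBigSupport.not_isLeaf {c : V} (h : IsBigSupport F c) : ¬ IsLeaf F c := by
  rintro ⟨x, hx⟩
  obtain ⟨b, s, t, hb, hs, ht, -, -, hst⟩ := h
  exact hst ((hx.2 s hs).trans (hx.2 t ht).symm)

theorem IsBigSupport.not_hasTwoNeighbors {c v w : V} (h : IsBigSupport F c) :
    ¬ HasTwoNeighbors F c v w := by
  rintro ⟨-, -, -, hx⟩
  obtain ⟨b, s, t, hb, hs, ht, h1, h2, h3⟩ := h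
  have := hx b hb.1.symm; have := hx s hs; have := hx t ht
  grind

theorem IsBigSupport.not_isCriticalEnd {c v : V} (h : IsBigSupport F c) :
    ¬ IsCriticalEnd F c v := by
  rintro (h' | ⟨b, h', -⟩ | ⟨b, h', -⟩)
  · exact h.not_isLeaf ⟨_, h'⟩
  · exact h.not_hasTwoNeighbors h'
  · exact h.not_hasTwoNeighbors h'

theorem HasTwoNeighbors.not_isLeaf {u v w : V} (h : HasTwoNeighbors F u v w) : ¬ IsLeaf F u := by
  rintro ⟨x, hx⟩
  exact h.1 ((hx.2 v h.2.1).trans (hx.2 w h.2.2.1).symm)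

theorem IsConnector.not_isLeaf {u : V} (h : IsConnector F u) : ¬ IsLeaf F u := by
  obtain ⟨v, w, h, -⟩ := h
  exact h.not_isLeaf

theorem IsConnector.isBigSupport_of_adj {u d : V} (h : IsConnector F u) (hd : F.Adj u d) :
    IsBigSupport F d := by
  obtain ⟨v, w, h, hv, hw⟩ := h
  rcases h.2.2.2 d hd with rfl | rfl
  · exact hv
  · exact hw

theorem IsSupport.not_isConnector {s : V} (h : IsSupport F s) : ¬ IsConnector F s := by
  obtain ⟨a, ha⟩ := h
  exact fun hc => (hc.isBigSupport_of_adj ha.1.symm).not_isLeaf ⟨_, ha⟩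

theorem IsSupport.not_isLeaf (hF : IsAdmissible F) {s : V} (h : IsSupport F s) :
    ¬ IsLeaf F s := by
  obtain ⟨a, ha⟩ := h
  rintro ⟨b, hb⟩
  obtain rfl := hb.2 a ha.1.symm
  exact hF.not_leaf _ _ ha hb

theorem IsLeaf.isLeafAt {a s : V} (h : IsLeaf F a) (has : F.Adj a s) : IsLeafAt F a s := by
  obtain ⟨c, hc⟩ := h
  obtain rfl := hc.2 s has
  exact hc

theorem IsP3Center.isNeedy (hF : IsAdmissible F) {s : V} (h : IsP3Center F s) : IsNeedy F s := by
  obtain ⟨a, b, hab, ha, hb⟩ := h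
  refine ⟨⟨a, ha⟩, fun d hd => Or.inl ?_⟩
  rcases hF.eq_or_eq a b s hab ha hb d hd with rfl | rfl
  exacts [⟨s, ha⟩, ⟨s, hb⟩]

/-- In an edge-minimal admissible graph, the neighbors of a vertex that is neither a leaf, nor a
support vertex, nor a connector are support vertices of degree 2. -/
theorem hasTwoNeighbors_of_adj_of_minimal (hF : Minimal IsAdmissible F) {r w : V}
    (hl : ¬ IsLeaf F r) (hs : ¬ IsSupport F r) (hc : ¬ IsConnector F r) (hrw : F.Adj r w) :
    ∃ b, HasTwoNeighbors F w r b ∧ IsLeafAt F b w := by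
  rcases isCriticalEnd_or_of_minimal hF hrw with
    (h | ⟨b, -, h⟩ | ⟨c, h, hbig⟩) | (h | h | ⟨c, h, hbig⟩)
  · exact absurd ⟨_, h⟩ hl
  · exact absurd ⟨_, h⟩ hs
  · rcases isCriticalEnd_or_of_minimal hF h.2.2.1 with (h' | ⟨b, -, h'⟩ | ⟨c', h', hbig'⟩) | h'
    · exact absurd ⟨_, h'⟩ hl
    · exact absurd ⟨_, h'⟩ hs
    · obtain rfl := (h'.2.2.2 w hrw).resolve_left h.1
      exact absurd ⟨w, c, h, hbig', hbig⟩ hc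
    · exact absurd h' hbig.not_isCriticalEnd
  · exact absurd ⟨_, h⟩ hs
  · exact h
  · rcases isCriticalEnd_or_of_minimal hF h.2.2.1 with (h' | ⟨b, h', h''⟩ | ⟨c', h', hbig'⟩) | h'
    · exact absurd ⟨_, h'⟩ h.not_isLeaf
    · obtain rfl := (h'.2.2.2 r hrw.symm).resolve_left h.1
      exact absurd ⟨_, h''⟩ hl
    · obtain rfl := (h'.2.2.2 r hrw.symm).resolve_left h.1
      exact absurd hbig'.isSupport hs
    · exact absurd h' hbig.not_isCriticalEnd

/-- All vertices other than leaves and connectors, together with a set `X` that contains a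
neighbor of every needy vertex, form a sparse total dominating set: connectors have two neighbors
in it, and distinct leaves outside it have distinct support vertices. -/
theorem isSparseTD_of_hitting (hF : IsAdmissible F) {D : Set V}
    (hD : ∀ v, ¬ IsLeaf F v → ¬ IsConnector F v → v ∈ D)
    (hX : ∀ s, IsNeedy F s → ∃ x ∈ D, F.Adj s x) : IsSparseTD F D := by
  have hsup : ∀ s, IsSupport F s → s ∈ D := fun s h => hD s (h.not_isLeaf hF) h.not_isConnector
  refine ⟨fun v => ?_, ?_⟩
  · by_cases hl : IsLeaf F v
    · obtain ⟨s, hs⟩ := hl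
      exact ⟨s, hsup s ⟨v, hs⟩, hs.1⟩
    by_cases hv : IsSupport F v
    · by_cases hn : IsNeedy F v
      · exact hX v hn
      · simp only [IsNeedy, hv, true_and, not_forall, not_or] at hn
        obtain ⟨d, hvd, hd1, hd2⟩ := hn
        exact ⟨d, hD d hd1 hd2, hvd⟩
    · obtain ⟨d, hvd⟩ := hF.exists_adj v
      by_cases hc : IsConnector F v
      · exact ⟨d, hsup d (hc.isBigSupport_of_adj hvd).isSupport, hvd⟩
      · refine ⟨d, hD d (fun h => ?_) (fun h => ?_), hvd⟩
        · exact hv ⟨d, h.isLeafAt hvd.symm⟩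
        · exact hv (h.isBigSupport_of_adj hvd.symm).isSupport
  · have key : ∀ d u, IsExtPrivate F D d u → IsLeafAt F u d := by
      rintro d u ⟨hu, hd, hud, hall⟩
      by_cases hl : IsLeaf F u
      · exact hl.isLeafAt hud
      by_cases hc : IsConnector F u
      · obtain ⟨v, w, h, hv, hw⟩ := hc
        exact absurd ((hall v (hsup v hv.isSupport) h.2.1).trans
          (hall w (hsup w hw.isSupport) h.2.2.1).symm) h.1
      · exact absurd (hD u hl hc) hu
    intro d u v hu hv
    by_contra hne
    have hu' := key d u hu
    have hv' := key d v hv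
    obtain ⟨x, hx, hdx⟩ := hX d (IsP3Center.isNeedy hF ⟨u, v, hne, hu', hv'⟩)
    rcases hF.eq_or_eq u v d hne hu' hv' x hdx with rfl | rfl
    exacts [hu.1 hx, hv.1 hx]

end Structure

open Finset in
/-- An edge-minimal admissible graph has a small sparse total dominating set, unless it is a
disjoint union of paths `P₃`. -/
theorem hasSmallSparseTD_or_of_minimal [Fintype V] {F : SimpleGraph V}
    (hF : Minimal IsAdmissible F) :
    (∃ D : Finset V, IsSparseTD F (D : Set V) ∧ 3 * D.card ≤ 2 * Fintype.card V) ∧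
      (HasSmallSparseTD F ∨ ∀ v, IsLeaf F v ∨ IsP3Center F v) := by
  classical
  have hA := hF.1
  -- a leaf at each support vertex, and a second one at the center of each `P₃`
  have hf1 : ∀ s, ∃ a, IsSupport F s → IsLeafAt F a s := fun s => by
    by_cases h : IsSupport F s
    · obtain ⟨a, ha⟩ := h; exact ⟨a, fun _ => ha⟩
    · exact ⟨s, fun h' => absurd h' h⟩
  choose f₁ hf1 using hf1
  have hf2 : ∀ s, ∃ a, IsP3Center F s → IsLeafAt F a s ∧ a ≠ f₁ s := fun s => by
    by_cases h : IsP3Center F s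
    · obtain ⟨a, b, hab, ha, hb⟩ := h
      by_cases h : a = f₁ s
      · exact ⟨b, fun _ => ⟨hb, fun h' => hab (h.trans h'.symm)⟩⟩
      · exact ⟨a, fun _ => ⟨ha, h⟩⟩
    · exact ⟨s, fun h' => absurd h' h⟩
  choose f₂ hf2 using hf2
  have hleafEq : ∀ {a s t}, IsLeafAt F a s → IsLeafAt F a t → s = t :=
    fun {a s t} h h' => h'.2 s h.1
  -- `R` are the vertices whose neighbors are supports of degree 2, `P` the centers of the paths
  -- `P₃`, `T` the other needy vertices, `U` the supports that are not needy, and `B` the vertices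
  -- that always belong to the dominating set
  set L : Finset V := {v | IsLeaf F v} with hL
  set S : Finset V := {v | IsSupport F v} with hS
  set C : Finset V := {v | IsConnector F v} with hC
  set R : Finset V := {v | ¬ IsLeaf F v ∧ ¬ IsSupport F v ∧ ¬ IsConnector F v} with hR
  set P : Finset V := {v | IsP3Center F v} with hP
  set N : Finset V := {v | IsNeedy F v} with hN
  set T : Finset V := N \ P with hT
  set U : Finset V := S \ N with hU
  set B : Finset V := {v | ¬ IsLeaf F v ∧ ¬ IsConnector F v} with hB
  have hPN : P ⊆ N := fun s hs => by
    simp only [hP, hN, mem_filter, mem_univ, true_and] at hs ⊢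
    exact hs.isNeedy hA
  have hNS : N ⊆ S := fun s hs => by
    simp only [hS, hN, mem_filter, mem_univ, true_and] at hs ⊢
    exact hs.1
  have hcardN : T.card + P.card = N.card := card_sdiff_add_card_eq_card hPN
  have hcardS : U.card + N.card = S.card := card_sdiff_add_card_eq_card hNS
  have hcardB : B.card ≤ S.card + R.card := by
    refine (card_le_card ?_).trans (card_union_le S R)
    intro v hv
    simp only [hB, hS, hR, mem_filter, mem_univ, true_and, mem_union] at hv ⊢
    tauto
  have hcardV : L.card + S.card + C.card + R.card ≤ Fintype.card V := by
    rw [← card_union_of_disjoint, ← card_union_of_disjoint, ← card_union_of_disjoint]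
    · exact card_le_univ _
    · rw [Finset.disjoint_left]; intro v hv hv'
      simp only [hL, hS, hR, hC, mem_filter, mem_univ, true_and, mem_union] at hv hv'
      tauto
    · rw [Finset.disjoint_left]; intro v hv hv'
      simp only [hL, hS, hC, mem_filter, mem_univ, true_and, mem_union] at hv hv'
      exact hv.elim hv'.not_isLeaf fun h => h.not_isConnector hv'
    · rw [Finset.disjoint_left]; intro v hv hv'
      simp only [hL, hS, mem_filter, mem_univ, true_and] at hv hv'
      exact hv'.not_isLeaf hA hv
  have hcardL : S.card + P.card ≤ L.card := by
    have h1 : (S.image f₁).card = S.card := by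
      refine card_image_of_injOn fun s hs t ht hst => ?_
      simp only [hS, coe_filter, mem_univ, true_and, Set.mem_ofPred_eq] at hs ht
      exact hleafEq (hf1 s hs) (hst ▸ hf1 t ht)
    have h2 : (P.image f₂).card = P.card := by
      refine card_image_of_injOn fun s hs t ht hst => ?_
      simp only [hP, coe_filter, mem_univ, true_and, Set.mem_ofPred_eq] at hs ht
      exact hleafEq (hf2 s hs).1 (hst ▸ (hf2 t ht).1)
    rw [← h1, ← h2, ← card_union_of_disjoint]
    · refine card_le_card fun a ha => ?_
      simp only [hL, hS, hP, mem_union, mem_image, mem_filter, mem_univ, true_and] at ha ⊢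
      rcases ha with ⟨s, hs, rfl⟩ | ⟨s, hs, rfl⟩
      exacts [⟨s, hf1 s hs⟩, ⟨s, (hf2 s hs).1⟩]
    · rw [Finset.disjoint_left]; intro a ha hb
      simp only [hS, hP, mem_image, mem_filter, mem_univ, true_and] at ha hb
      obtain ⟨s, hs, rfl⟩ := ha
      obtain ⟨t, ht, hst⟩ := hb
      obtain rfl := hleafEq (hf1 s hs) (hst ▸ (hf2 t ht).1)
      exact (hf2 s ht).2 hst
  -- each needy vertex outside the paths `P₃` has two connectors as neighbors
  have hcardT : T.card * 2 ≤ C.card * 2 := by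
    refine card_mul_le_card_mul F.Adj (fun s hs => ?_) (fun u hu => ?_)
    · simp only [hT, hN, hP, mem_sdiff, mem_filter, mem_univ, true_and] at hs
      obtain ⟨⟨⟨a, ha⟩, hall⟩, hp⟩ := hs
      have hnl : ∀ d, F.Adj s d → d ≠ a → IsConnector F d := fun d hd hda =>
        (hall d hd).resolve_left fun h => hp ⟨d, a, hda, h.isLeafAt hd.symm, ha⟩
      have : ∃ d, F.Adj s d ∧ d ≠ a := by
        by_contra hno
        push Not at hno
        exact hA.not_leaf a s ha ⟨ha.1.symm, hno⟩
      obtain ⟨d, hd, hda⟩ := this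
      obtain ⟨b, x, y, hb, hx, hy, hxb, hyb, hxy⟩ :=
        (hnl d hd hda).isBigSupport_of_adj hd.symm
      have hab : b = a := by
        by_contra h
        exact hp ⟨b, a, h, hb, ha⟩
      subst hab
      rw [← card_pair hxy]
      refine card_le_card fun z hz => ?_
      simp only [bipartiteAbove, hC, mem_filter, mem_univ, true_and, mem_insert,
        mem_singleton] at hz ⊢
      rcases hz with rfl | rfl
      exacts [⟨hnl _ hx hxb, hx⟩, ⟨hnl _ hy hyb, hy⟩]
    · simp only [hC, mem_filter, mem_univ, true_and] at hu
      obtain ⟨v, w, h, -, -⟩ := hu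
      refine le_trans (card_le_card ?_) (card_le_two (a := v) (b := w))
      intro z hz
      simp only [bipartiteBelow, mem_filter, mem_insert, mem_singleton] at hz ⊢
      exact h.2.2.2 z hz.2.symm
  -- a vertex of `R` has two neighbors in `U`, each of which has no other neighbor in `R`
  have hcardR : R.card * 2 ≤ U.card * 1 := by
    refine card_mul_le_card_mul F.Adj (fun r hr => ?_) (fun u hu => ?_)
    · simp only [hR, mem_filter, mem_univ, true_and] at hr
      obtain ⟨hl, hs, hc⟩ := hr
      obtain ⟨x, hx⟩ := hA.exists_adj r
      have : ∃ y, F.Adj r y ∧ y ≠ x := by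
        by_contra hno
        push Not at hno
        exact hl ⟨x, hx, hno⟩
      obtain ⟨y, hy, hyx⟩ := this
      rw [← card_pair hyx]
      refine card_le_card fun z hz => ?_
      have hrz : F.Adj r z := by
        simp only [mem_insert, mem_singleton] at hz
        rcases hz with rfl | rfl <;> assumption
      obtain ⟨b, -, hb⟩ := hasTwoNeighbors_of_adj_of_minimal hF hl hs hc hrz
      simp only [bipartiteAbove, hU, hS, hN, mem_sdiff, mem_filter, mem_univ, true_and]
      exact ⟨⟨⟨b, hb⟩, fun h => (h.2 r hrz.symm).elim hl hc⟩, hrz⟩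
    · refine card_le_one.2 fun r hr r' hr' => ?_
      simp only [bipartiteBelow, hR, mem_filter, mem_univ, true_and] at hr hr'
      obtain ⟨b, h, hb⟩ := hasTwoNeighbors_of_adj_of_minimal hF hr.1.1 hr.1.2.1 hr.1.2.2 hr.2
      refine ((h.2.2.2 r' hr'.2.symm).resolve_right ?_).symm
      rintro rfl
      exact hr'.1.1 ⟨_, hb⟩
  have hBD : ∀ X : Finset V, ∀ v, ¬ IsLeaf F v → ¬ IsConnector F v →
      v ∈ ((B ∪ X : Finset V) : Set V) := fun X v h1 h2 => by
    simp [hB, h1, h2]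
  -- the leaf chosen at a needy vertex serves as its neighbor in the dominating set
  have hD1 : IsSparseTD F ((B ∪ N.image f₁ : Finset V) : Set V) := by
    refine isSparseTD_of_hitting hA (hBD _) fun s hs => ⟨f₁ s, ?_, (hf1 s hs.1).1.symm⟩
    rw [mem_coe, mem_union]
    exact Or.inr (mem_image_of_mem _ (by simpa [hN] using hs))
  have hcD1 : (B ∪ N.image f₁).card ≤ B.card + N.card :=
    (card_union_le _ _).trans (Nat.add_le_add_left card_image_le _)
  refine ⟨⟨_, hD1, by omega⟩, ?_⟩
  by_cases hU0 : U.card = 0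
  swap
  · exact Or.inl ⟨_, hD1, by omega⟩
  by_cases hTC : T.card = C.card
  swap
  · exact Or.inl ⟨_, hD1, by omega⟩
  have hR0 : R.card = 0 := by omega
  by_cases hC0 : C.card = 0
  · refine Or.inr fun v => ?_
    rw [hC0] at hTC
    rw [card_eq_zero] at hU0 hTC hR0 hC0
    have h1 := eq_empty_iff_forall_notMem.1 hU0 v
    have h2 := eq_empty_iff_forall_notMem.1 hTC v
    have h3 := eq_empty_iff_forall_notMem.1 hR0 v
    have h4 := eq_empty_iff_forall_notMem.1 hC0 v
    simp only [hU, hT, hR, hC, hS, hN, hP, mem_sdiff, mem_filter, mem_univ, true_and] at h1 h2 h3 h4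
    tauto
  · -- a connector serves both of its neighbors, which saves one vertex
    left
    obtain ⟨u, hu⟩ := card_pos.1 (Nat.pos_of_ne_zero hC0)
    rw [card_eq_zero] at hU0
    simp only [hC, mem_filter, mem_univ, true_and] at hu
    have hnbr : ∀ d, F.Adj u d → d ∈ N := fun d hd => by
      by_contra h
      refine eq_empty_iff_forall_notMem.1 hU0 d ?_
      simp only [hU, mem_sdiff, h, not_false_eq_true, and_true, hS, mem_filter, mem_univ, true_and]
      exact (hu.isBigSupport_of_adj hd).isSupport
    obtain ⟨v, w, ⟨hvw, huv, huw, -⟩, -, -⟩ := id hu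
    have hsub : ({v, w} : Finset V) ⊆ N := by
      intro z hz
      simp only [mem_insert, mem_singleton] at hz
      rcases hz with rfl | rfl
      exacts [hnbr _ huv, hnbr _ huw]
    have hD2 : IsSparseTD F ((B ∪ insert u ((N \ {v, w}).image f₁) : Finset V) : Set V) := by
      refine isSparseTD_of_hitting hA (hBD _) fun s hs => ?_
      by_cases hsvw : s ∈ ({v, w} : Finset V)
      · refine ⟨u, ?_, ?_⟩
        · simp
        · simp only [mem_insert, mem_singleton] at hsvw
          rcases hsvw with rfl | rfl
          exacts [huv.symm, huw.symm]
      · refine ⟨f₁ s, ?_, (hf1 s hs.1).1.symm⟩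
        rw [mem_coe, mem_union]
        refine Or.inr (mem_insert_of_mem (mem_image_of_mem _ ?_))
        rw [mem_sdiff]
        exact ⟨by simpa [hN] using hs, hsvw⟩
    refine ⟨_, hD2, ?_⟩
    have h1 : (B ∪ insert u ((N \ {v, w}).image f₁)).card ≤ B.card + ((N \ {v, w}).card + 1) :=
      (card_union_le _ _).trans (Nat.add_le_add_left
        ((card_insert_le _ _).trans (Nat.add_le_add_right card_image_le _)) _)
    have h2 : (N \ {v, w}).card + 2 = N.card := by
      rw [← card_pair hvw]
      exact card_sdiff_add_card_eq_card hsub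
    omega

/-! ### Graphs with a perfect `P₃`-packing -/

/-- A spanning family of disjoint paths `P₃`, indexed by `W`: the `w`-th path is
`(w, 0), (w, 1), (w, 2)`. -/
def HasP3Packing {W : Type*} (K : SimpleGraph (W × Fin 3)) : Prop :=
  ∀ w i, i ≠ 1 → K.Adj (w, i) (w, 1)

section Packing

variable {W : Type u} {K : SimpleGraph (W × Fin 3)}

/-- Let `D` contain the middle vertex `(w, 1)` and the end `(w, t w)` of every path outside a set
`M` of modified paths. Then only the vertices of the modified paths have to be checked in order
to see that `D` is a sparse total dominating set. -/
theorem HasP3Packing.isSparseTD (hK : HasP3Packing K) {D : Set (W × Fin 3)} (M : Set W)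
    (t : W → Fin 3) (g : W × Fin 3 → W × Fin 3)
    (ht : ∀ w, w ∉ M → t w ≠ 1)
    (hD : ∀ w i, w ∉ M → ((w, i) ∈ D ↔ i = 1 ∨ i = t w))
    (htd : ∀ w i, w ∈ M → ∃ d ∈ D, K.Adj (w, i) d)
    (hg : ∀ w i, w ∈ M → (w, i) ∉ D → g (w, i) ∈ D ∧ K.Adj (w, i) (g (w, i)) ∧
      ((∃ e ∈ D, K.Adj (w, i) e ∧ e ≠ g (w, i)) ∨ ((∀ v, v ∉ M → g (w, i) ≠ (v, 1)) ∧
        ∀ w' i', w' ∈ M → (w', i') ∉ D → g (w', i') = g (w, i) → (w', i') = (w, i)))) :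
    IsSparseTD K D := by
  classical
  refine isSparseTD_of_choice (fun p => if p.1 ∈ M then g p else (p.1, 1)) ?_ ?_ ?_
  · rintro ⟨w, i⟩
    by_cases hw : w ∈ M
    · exact htd w i hw
    · by_cases hi : i = 1
      · subst hi
        exact ⟨(w, t w), (hD w _ hw).2 (Or.inr rfl), (hK w _ (ht w hw)).symm⟩
      · exact ⟨(w, 1), (hD w _ hw).2 (Or.inl rfl), hK w i hi⟩
  · rintro ⟨w, i⟩ hi
    by_cases hw : w ∈ M
    · simp only [hw, if_true]
      exact ⟨(hg w i hw hi).1, (hg w i hw hi).2.1⟩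
    · simp only [hw, if_false]
      exact ⟨(hD w _ hw).2 (Or.inl rfl), hK w i fun h => hi ((hD w i hw).2 (Or.inl h))⟩
  · rintro ⟨w, i⟩ ⟨w', i'⟩ hi hi' heq hne
    by_cases hw : w ∈ M <;> by_cases hw' : w' ∈ M <;>
      simp only [hw, hw', if_true, if_false] at heq ⊢
    · rcases (hg w i hw hi).2.2 with h | h
      · exact Or.inl h
      · exact absurd (h.2 w' i' hw' hi' heq.symm).symm hne
    · rcases (hg w i hw hi).2.2 with h | h
      · exact Or.inl h
      · exact absurd heq (h.1 w' hw')
    · rcases (hg w' i' hw' hi').2.2 with h | h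
      · exact Or.inr h
      · exact absurd heq.symm (h.1 w hw)
    · obtain rfl : w = w' := congrArg Prod.fst heq
      exfalso
      have h1 := ht w hw
      rw [hD w i hw] at hi
      rw [hD w i' hw] at hi'
      have h3 : i ≠ i' := fun h => hne (by rw [h])
      omega

/-- Selecting at most two vertices of every path, and at most one vertex of some path, is enough
for a set on less than two thirds of the vertices. -/
theorem hasSmallSparseTD_of_select [Fintype W] (sel : W → Finset (Fin 3))
    (h2 : ∀ w, (sel w).card ≤ 2) (w₀ : W) (h1 : (sel w₀).card ≤ 1)
    (h : IsSparseTD K {p | p.2 ∈ sel p.1}) : HasSmallSparseTD K := by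
  classical
  refine ⟨Finset.univ.sigma sel |>.map (Equiv.sigmaEquivProd W (Fin 3)).toEmbedding, ?_, ?_⟩
  · convert h using 1
    ext ⟨w, i⟩
    simp [Equiv.sigmaEquivProd]
  · rw [Finset.card_map, Finset.card_sigma, Fintype.card_prod, Fintype.card_fin]
    have : ∑ w, (sel w).card < ∑ _w : W, 2 :=
      Finset.sum_lt_sum (fun w _ => h2 w) ⟨w₀, Finset.mem_univ _, by omega⟩
    simp only [Finset.sum_const, Finset.card_univ, smul_eq_mul] at this
    omega

variable [Fintype W]

/-- If a path has edges to other paths at its middle `(P, 1)` and at an end `(P, a)`, then a vertex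
can be saved. Usually the `P`-th path keeps its middle alone, and the ends of the other two paths
are chosen so that both cross edges lead to the set; `(P, a)` then has two neighbors in the set.
This fails if the cross edges go to both ends of the same path `Q`, in which case the `P`-th path
keeps `(P, 1)` and `(P, a)`, and the `Q`-th path only the end `(Q, j)`. -/
theorem HasP3Packing.small_of_middle_end (hK : HasP3Packing K) {P Q R : W} {j k a : Fin 3}
    (hQ : Q ≠ P) (hR : R ≠ P) (ha : a ≠ 1) (h1 : K.Adj (P, 1) (Q, j)) (h2 : K.Adj (P, a) (R, k)) :
    HasSmallSparseTD K := by
  classical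
  by_cases hjk : Q = R ∧ j ≠ 1 ∧ k ≠ 1 ∧ j ≠ k
  · obtain ⟨rfl, hj, hk, hjk⟩ := hjk
    refine hasSmallSparseTD_of_select
      (fun w => if w = Q then {j} else {1, if w = P then a else 0}) (fun w => ?_) Q (by simp) ?_
    · split_ifs <;> first | exact Finset.card_le_two | simp
    refine hK.isSparseTD {Q} (fun w => if w = P then a else 0)
      (fun p => if p.2 = 1 then (Q, j) else (P, a)) ?_ ?_ ?_ ?_
    · intro w _; split_ifs <;> simp [ha]
    · intro w i hw; simp at hw; simp [hw]
    · rintro w i rfl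
      have : i = 1 ∨ i = j ∨ i = k := by omega
      rcases this with rfl | rfl | rfl
      · exact ⟨(w, j), by simp, (hK w j hj).symm⟩
      · exact ⟨(P, 1), by simp [hQ.symm], h1.symm⟩
      · exact ⟨(P, a), by simp [hQ.symm], h2.symm⟩
    · rintro w i rfl hi
      have hi : i ≠ j := by simpa using hi
      have : i = 1 ∨ i = k := by omega
      rcases this with rfl | rfl
      · refine ⟨by simp, by simpa using (hK w j hj).symm, Or.inr ⟨by simp [hj], ?_⟩⟩
        rintro w' i' rfl hi'
        by_cases h : i' = 1
        · simp [h]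
        · simp [h, hQ.symm]
      · refine ⟨by simp [hk, hQ.symm], by simpa [hk] using h2.symm,
          Or.inr ⟨by simp [hk, ha], ?_⟩⟩
        rintro w' i' rfl hi'
        have : i' ≠ j := by simpa using hi'
        by_cases h : i' = 1
        · simp [h, hk, hQ]
        · have : i' = i := by omega
          simp [this]
  · refine hasSmallSparseTD_of_select
      (fun w => if w = P then {1} else {1, if w = Q ∧ j ≠ 1 then j else
        if w = R ∧ k ≠ 1 then k else 0}) (fun w => ?_) P (by simp) ?_
    · split_ifs <;> first | exact Finset.card_le_two | simp
    have hjD : j = 1 ∨ j = (if Q = Q ∧ j ≠ 1 then j else if Q = R ∧ k ≠ 1 then k else 0) := by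
      by_cases h : j = 1 <;> simp [h]
    have hkD : k = 1 ∨ k = (if R = Q ∧ j ≠ 1 then j else if R = R ∧ k ≠ 1 then k else 0) := by
      by_cases h : k = 1
      · exact Or.inl h
      · by_cases h' : R = Q ∧ j ≠ 1
        · rw [if_pos h']
          right
          by_contra hne
          exact hjk ⟨h'.1.symm, h'.2, h, fun e => hne e.symm⟩
        · simp [h', h]
    refine hK.isSparseTD {P} (fun w => if w = Q ∧ j ≠ 1 then j else
        if w = R ∧ k ≠ 1 then k else 0)
      (fun p => if p.2 = a then (R, k) else (P, 1)) ?_ ?_ ?_ ?_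
    · intro w _; split_ifs with h h' <;> simp_all
    · intro w i hw; simp at hw; simp [hw]
    · rintro w i rfl
      by_cases hi : i = 1
      · subst hi
        exact ⟨(Q, j), by simpa [hQ] using hjD, h1⟩
      · exact ⟨(w, 1), by simp, hK w i hi⟩
    · rintro w i rfl hi
      have hi : i ≠ 1 := by simpa using hi
      by_cases hia : i = a
      · subst hia
        refine ⟨by simpa [hR] using hkD, by simpa using h2, Or.inl ⟨(w, 1), by simp, hK w i hi, ?_⟩⟩
        simp [hR.symm]
      · refine ⟨by simp [hia], by simpa [hia] using hK w i hi, Or.inr ⟨?_, ?_⟩⟩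
        · intro v hv
          simp at hv
          simp [hia, Ne.symm hv]
        · rintro w' i' rfl hi'
          have hi' : i' ≠ 1 := by simpa using hi'
          by_cases h : i' = a
          · simp [h, hia, hR]
          · have : i' = i := by omega
            simp [this]

/-- If the two ends of a path have edges to ends of two different other paths, then the path can
do with the single vertex `(P, a)`. -/
theorem HasP3Packing.small_of_ends (hK : HasP3Packing K) {P Q R : W} {a b j k : Fin 3}
    (hQ : Q ≠ P) (hR : R ≠ P) (hQR : Q ≠ R) (ha : a ≠ 1) (hb : b ≠ 1) (hab : a ≠ b)
    (hj : j ≠ 1) (hk : k ≠ 1) (h1 : K.Adj (P, a) (Q, j)) (h2 : K.Adj (P, b) (R, k)) :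
    HasSmallSparseTD K := by
  classical
  refine hasSmallSparseTD_of_select
    (fun w => if w = P then {a} else {1, if w = Q then j else k}) (fun w => ?_) P (by simp) ?_
  · split_ifs <;> first | exact Finset.card_le_two | simp
  refine hK.isSparseTD {P} (fun w => if w = Q then j else k)
    (fun p => if p.2 = 1 then (P, a) else (R, k)) ?_ ?_ ?_ ?_
  · intro w _; split_ifs <;> assumption
  · intro w i hw; simp at hw; simp [hw]
  · rintro w i rfl
    have : i = 1 ∨ i = a ∨ i = b := by omega
    rcases this with rfl | rfl | rfl
    · exact ⟨(w, a), by simp, (hK w a ha).symm⟩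
    · exact ⟨(Q, j), by simp [hQ], h1⟩
    · exact ⟨(R, k), by simp [hR, hQR.symm], h2⟩
  · rintro w i rfl hi
    have hi : i ≠ a := by simpa using hi
    have : i = 1 ∨ i = b := by omega
    rcases this with rfl | rfl
    · refine ⟨by simp, by simpa using (hK w a ha).symm, Or.inr ⟨by simp [ha], ?_⟩⟩
      rintro w' i' rfl hi'
      by_cases h : i' = 1
      · simp [h]
      · simp [h, hR]
    · refine ⟨by simp [hb, hR, hQR.symm], by simpa [hb] using h2, Or.inr ⟨by simp [hb, hk], ?_⟩⟩
      rintro w' i' rfl hi'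
      have : i' ≠ a := by simpa using hi'
      by_cases h : i' = 1
      · simp [h, hb, hR.symm]
      · have : i' = i := by omega
        simp [this]

/-- Two paths that form a 6-cycle with a chord joining the ends of the `P`-th path are handled by
the three vertices `(P, a)`, `(P, b)`, `(Q, j)`. -/
theorem HasP3Packing.small_of_chord (hK : HasP3Packing K) {P Q : W} {a b j k : Fin 3}
    (hQ : Q ≠ P) (ha : a ≠ 1) (hb : b ≠ 1) (hab : a ≠ b) (hj : j ≠ 1) (hk : k ≠ 1) (hjk : j ≠ k)
    (h1 : K.Adj (P, a) (Q, j)) (h2 : K.Adj (P, b) (Q, k)) (h3 : K.Adj (P, a) (P, b)) :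
    HasSmallSparseTD K := by
  classical
  refine hasSmallSparseTD_of_select
    (fun w => if w = P then {a, b} else if w = Q then {j} else {1, 0}) (fun w => ?_) Q
      (by simp [hQ]) ?_
  · split_ifs <;> first | exact Finset.card_le_two | simp
  refine hK.isSparseTD {P, Q} (fun _ => 0)
    (fun p => if p.1 = P then (P, a) else if p.2 = 1 then (Q, j) else (P, b)) ?_ ?_ ?_ ?_
  · intro w _; simp
  · intro w i hw
    simp only [Set.mem_insert_iff, Set.mem_singleton_iff, not_or] at hw
    simp [hw.1, hw.2]
  · rintro w i (rfl | rfl)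
    · by_cases hi : i = a
      · exact ⟨(w, b), by simp, hi ▸ h3⟩
      · refine ⟨(w, a), by simp, ?_⟩
        have : i = 1 ∨ i = b := by omega
        rcases this with rfl | rfl
        exacts [(hK w a ha).symm, h3.symm]
    · have : i = 1 ∨ i = j ∨ i = k := by omega
      rcases this with rfl | rfl | rfl
      · exact ⟨(w, j), by simp [hQ], (hK w j hj).symm⟩
      · exact ⟨(P, a), by simp, h1.symm⟩
      · exact ⟨(P, b), by simp, h2.symm⟩
  · rintro w i (rfl | rfl) hi
    · have hi : i ≠ a ∧ i ≠ b := by simpa using hi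
      obtain rfl : i = 1 := by omega
      refine ⟨by simp, by simpa using (hK w a ha).symm, Or.inl ⟨(w, b), by simp,
        (hK w b hb).symm, ?_⟩⟩
      simp [hab.symm]
    · have hi : i ≠ j := by simpa [hQ] using hi
      have : i = 1 ∨ i = k := by omega
      rcases this with rfl | rfl
      · refine ⟨by simp [hQ], by simpa [hQ] using (hK w j hj).symm, Or.inr ⟨by simp [hQ, hj], ?_⟩⟩
        rintro w' i' (rfl | rfl) hi'
        · simp [hQ, hQ.symm]
        · by_cases h : i' = 1 <;> simp [h, hQ, hQ.symm]
      · refine ⟨by simp [hQ, hk], by simpa [hQ, hk] using h2.symm,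
          Or.inr ⟨by simp [hQ, hk, hb], ?_⟩⟩
        rintro w' i' (rfl | rfl) hi'
        · simp [hQ, hk, hab]
        · have : i' ≠ j := by simpa [hQ] using hi'
          by_cases h : i' = 1
          · simp [h, hQ, hk]
          · have : i' = i := by omega
            simp [this]

end Packing

section Extremal

variable {W : Type u} {K : SimpleGraph (W × Fin 3)}

/-- An end of each path has a neighbor outside that path, since otherwise its two ends would be
twins. -/
theorem HasP3Packing.exists_adj_of_end (hK : HasP3Packing K) (htf : IsTwinFree K) (w : W) :
    ∃ i Q j, Q ≠ w ∧ K.Adj (w, i) (Q, j) ∧ i ≠ 1 := by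
  by_contra! h
  have hin : ∀ i j, K.Adj (w, i) (w, j) → i ≠ j := fun i j h h' => by
    subst h'; exact K.loopless.irrefl _ h
  have h0 := hK w 0 (by decide)
  have h2 := hK w 2 (by decide)
  have : ((w, 0) : W × Fin 3) ≠ (w, 2) := by simp
  by_cases h02 : K.Adj (w, 0) (w, 2)
  · refine this (htf.closed_eq ?_)
    rintro ⟨Q, j⟩
    by_cases hQ : Q = w
    · subst hQ
      fin_cases j <;> simp_all [h02.symm]
    · have a1 : ¬ K.Adj (w, 0) (Q, j) := fun h' => by simpa using h 0 Q j hQ h'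
      have a2 : ¬ K.Adj (w, 2) (Q, j) := fun h' => by simpa using h 2 Q j hQ h'
      simp [hQ, a1, a2]
  · refine this (htf.open_eq ?_)
    rintro ⟨Q, j⟩
    by_cases hQ : Q = w
    · subst hQ
      fin_cases j
      · simpa using fun h => h02 h.symm
      · simp [h0, h2]
      · simpa using h02
    · have a1 : ¬ K.Adj (w, 0) (Q, j) := fun h' => by simpa using h 0 Q j hQ h'
      have a2 : ¬ K.Adj (w, 2) (Q, j) := fun h' => by simpa using h 2 Q j hQ h'
      simp [a1, a2]

/-- If `(w, a)` is the only vertex of the `w`-th path with neighbors outside that path, then the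
path is induced, since otherwise its other two vertices would be closed twins. -/
theorem HasP3Packing.not_adj_ends (hK : HasP3Packing K) (htf : IsTwinFree K) (w : W) {a b : Fin 3}
    (ha : a ≠ 1) (hb : b ≠ 1) (hab : a ≠ b)
    (h : ∀ i Q j, Q ≠ w → K.Adj (w, i) (Q, j) → i = a) : ¬ K.Adj (w, a) (w, b) := by
  intro hadj
  have : ((w, 1) : W × Fin 3) ≠ (w, b) := by simp [hb.symm]
  refine this (htf.closed_eq ?_)
  rintro ⟨Q, j⟩
  by_cases hQ : Q = w
  · subst hQ
    have : j = 1 ∨ j = a ∨ j = b := by omega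
    rcases this with rfl | rfl | rfl
    · simp [hK Q b hb]
    · simp [(hK Q j ha).symm, hadj.symm]
    · simp [(hK Q j hb).symm]
  · have a1 : ¬ K.Adj (w, 1) (Q, j) := fun h' => ha (h 1 Q j hQ h').symm
    have a2 : ¬ K.Adj (w, b) (Q, j) := fun h' => hab (h b Q j hQ h').symm
    simp [hQ, a1, a2]

theorem HasP3Packing.not_adj_middle [Fintype W] (hK : HasP3Packing K) (htf : IsTwinFree K)
    (hno : ¬ HasSmallSparseTD K) {P Q : W} {j : Fin 3} (hQ : Q ≠ P) : ¬ K.Adj (P, 1) (Q, j) :=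
  fun hadj => by
    obtain ⟨i, R, k, hR, h, hi⟩ := hK.exists_adj_of_end htf P
    exact hno (hK.small_of_middle_end hQ hR hi hadj h)

/-- If every path has only one vertex with neighbors outside, and this is an end, then `K` is
the 2-corona of the graph induced by these ends. -/
theorem HasP3Packing.isC6OrTwoCorona_of_one_end (hK : HasP3Packing K) (htf : IsTwinFree K)
    (hC4 : NoFourCycle K) (hconn : K.Connected) (t : W → Fin 3) (ht : ∀ w, t w ≠ 1)
    (h : ∀ w i Q j, Q ≠ w → K.Adj (w, i) (Q, j) → i = t w) : IsC6OrTwoCorona K := by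
  classical
  set H : SimpleGraph W := K.comap fun w => (w, t w) with hH
  have hcross : ∀ {P i Q j}, P ≠ Q → K.Adj (P, i) (Q, j) → i = t P ∧ j = t Q :=
    fun {P i Q j} hPQ hadj => ⟨h P i Q j hPQ.symm hadj, h Q j P i hPQ hadj.symm⟩
  have hreach : ∀ p q : W × Fin 3, K.Reachable p q → H.Reachable p.1 q.1 := by
    rintro p q ⟨w⟩
    induction w with
    | nil => exact Reachable.refl _
    | @cons u v w hadj _ ih =>
      refine Reachable.trans ?_ ih
      by_cases huv : u.1 = v.1
      · rw [huv]
      · refine Adj.reachable ?_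
        obtain ⟨P, i⟩ := u
        obtain ⟨Q, j⟩ := v
        obtain ⟨hi, hj⟩ := hcross huv hadj
        simp only at hi hj
        subst hi hj
        exact hadj
  have hne : Nonempty W := ⟨hconn.nonempty.some.1⟩
  have hHconn : H.Connected :=
    ⟨fun P Q => hreach (P, 0) (Q, 0) (hconn.preconnected _ _)⟩
  have hnt : Nontrivial W := by
    by_contra hnt
    rw [not_nontrivial_iff_subsingleton] at hnt
    obtain ⟨i, Q, j, hQ, -⟩ := hK.exists_adj_of_end htf hne.some
    exact hQ (Subsingleton.elim _ _)
  have hHC4 : NoFourCycle H :=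
    noFourCycle_of_hom (G := K) ⟨fun w => (w, t w), fun h => h⟩
      (fun a b hab => congrArg Prod.fst hab) hC4
  refine Or.inr ⟨W, H, hHconn, hnt, hHC4, ⟨RelIso.symm ⟨(Equiv.refl W).prodShear
    fun w => Equiv.swap 0 (t w), ?_⟩⟩⟩
  rintro ⟨P, i⟩ ⟨Q, j⟩
  simp only [Equiv.prodShear_apply, Equiv.refl_apply]
  have hsw0 : ∀ w, Equiv.swap 0 (t w) 0 = t w := fun w => Equiv.swap_apply_left _ _
  have hsw1 : ∀ w, Equiv.swap 0 (t w) 1 = 1 := fun w =>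
    Equiv.swap_apply_of_ne_of_ne (by decide) (ht w).symm
  by_cases hPQ : P = Q
  · subst hPQ
    obtain ⟨s, hs, hs1, hst⟩ : ∃ s, Equiv.swap 0 (t P) 2 = s ∧ s ≠ 1 ∧ t P ≠ s := by
      have := ht P
      generalize t P = x at this ⊢
      revert x; decide
    have e1 := hK P (t P) (ht P)
    have e2 := hK P s hs1
    have e3 := hK.not_adj_ends htf P (ht P) hs1 hst (h P)
    have e4 : ¬ K.Adj (P, s) (P, t P) := fun h => e3 h.symm
    fin_cases i <;> fin_cases j <;>
      simp [hsw0, hsw1, hs, twoCorona, e1, e2, e1.symm, e2.symm, e3, e4]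
  · constructor
    · intro hadj
      obtain ⟨hi, hj⟩ := hcross hPQ hadj
      obtain rfl := Equiv.injective _ (hi.trans (hsw0 P).symm)
      obtain rfl := Equiv.injective _ (hj.trans (hsw0 Q).symm)
      exact Or.inl ⟨rfl, rfl, by simpa [hH, hsw0] using hadj⟩
    · rintro (⟨hi, hj, hadj⟩ | ⟨h, -⟩)
      · simp only at hi hj hadj
        subst hi hj
        simpa [hH, hsw0] using hadj
      · exact absurd h hPQ

theorem HasP3Packing.nonempty_iso_cycleGraph_six (hK : HasP3Packing K) {P Q : W} {a b j k : Fin 3}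
    (hQ : Q ≠ P) (hW : ∀ w, w = P ∨ w = Q) (ha : a ≠ 1) (hb : b ≠ 1) (hab : a ≠ b) (hj : j ≠ 1)
    (hk : k ≠ 1) (hjk : j ≠ k) (h1 : K.Adj (P, a) (Q, j)) (h2 : K.Adj (P, b) (Q, k))
    (h3 : ¬ K.Adj (P, a) (P, b)) (h4 : ¬ K.Adj (Q, j) (Q, k))
    (h5 : ¬ K.Adj (P, a) (Q, k)) (h6 : ¬ K.Adj (P, b) (Q, j))
    (h7 : ∀ i, ¬ K.Adj (P, 1) (Q, i)) (h8 : ∀ i, ¬ K.Adj (Q, 1) (P, i)) :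
    Nonempty (K ≃g cycleGraph 6) := by
  have hf : Function.Bijective
      (![(P, a), (P, 1), (P, b), (Q, k), (Q, 1), (Q, j)] : Fin 6 → W × Fin 3) := by
    constructor
    · intro x y hxy
      fin_cases x <;> fin_cases y <;> first | rfl | (exfalso; revert hxy; simp; grind)
    · rintro ⟨w, i⟩
      rcases hW w with rfl | rfl
      · have : i = a ∨ i = 1 ∨ i = b := by omega
        rcases this with rfl | rfl | rfl
        exacts [⟨0, rfl⟩, ⟨1, rfl⟩, ⟨2, rfl⟩]
      · have : i = k ∨ i = 1 ∨ i = j := by omega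
        rcases this with rfl | rfl | rfl
        exacts [⟨3, rfl⟩, ⟨4, rfl⟩, ⟨5, rfl⟩]
  refine ⟨RelIso.symm ⟨Equiv.ofBijective _ hf, ?_⟩⟩
  have sy : ∀ {x y}, ¬ K.Adj x y → ¬ K.Adj y x := fun h h' => h h'.symm
  have g1 := hK P a ha
  have g2 := hK P b hb
  have g3 := hK Q j hj
  have g4 := hK Q k hk
  intro x y
  rw [cycleGraph_adj]
  fin_cases x <;> fin_cases y <;> first
    | (refine iff_of_true ?_ (by decide); first
        | assumption | (apply SimpleGraph.Adj.symm; assumption))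
    | (refine iff_of_false ?_ (by decide); first
        | exact K.loopless.irrefl _ | assumption | (apply sy; assumption)
        | exact h7 _ | exact h8 _ | exact sy (h7 _) | exact sy (h8 _))

theorem HasP3Packing.isC6OrTwoCorona [Fintype W] (hK : HasP3Packing K) (htf : IsTwinFree K)
    (hC4 : NoFourCycle K) (hconn : K.Connected) (hno : ¬ HasSmallSparseTD K) :
    IsC6OrTwoCorona K := by
  have hmid : ∀ {P Q : W} {j : Fin 3}, Q ≠ P → ¬ K.Adj (P, 1) (Q, j) :=
    fun hQ => hK.not_adj_middle htf hno hQ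
  have hend : ∀ {P Q : W} {i j : Fin 3}, Q ≠ P → K.Adj (P, i) (Q, j) → i ≠ 1 ∧ j ≠ 1 := by
    intro P Q i j hQ h
    constructor
    · rintro rfl; exact hmid hQ h
    · rintro rfl; exact hmid hQ.symm h.symm
  have hends : ∀ {P Q R : W} {a b j k : Fin 3}, Q ≠ P → R ≠ P → a ≠ b → K.Adj (P, a) (Q, j) →
      K.Adj (P, b) (R, k) → Q = R := by
    intro P Q R a b j k hQ hR hab h1 h2
    by_contra hQR
    exact hno (hK.small_of_ends hQ hR hQR (hend hQ h1).1 (hend hR h2).1 hab (hend hQ h1).2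
      (hend hR h2).2 h1 h2)
  by_cases hall : ∀ w : W, ∃ t : Fin 3, t ≠ 1 ∧ ∀ i Q j, Q ≠ w → K.Adj (w, i) (Q, j) → i = t
  · choose t ht h using hall
    exact hK.isC6OrTwoCorona_of_one_end htf hC4 hconn t ht h
  push Not at hall
  obtain ⟨P, hP⟩ := hall
  obtain ⟨b, Q, k, hQ, h2, hb0⟩ := hP 0 (by decide)
  obtain ⟨a, Q', j, hQ', h1, hab⟩ := hP b (hend hQ h2).1
  obtain rfl := hends hQ' hQ hab h1 h2
  obtain ⟨ha, hj⟩ := hend hQ h1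
  obtain ⟨hb, hk⟩ := hend hQ h2
  have ne1 : ∀ {x : W} {i i' : Fin 3}, i ≠ i' → (x, i) ≠ (x, i') := fun h h' =>
    h (congrArg Prod.snd h')
  have ne2 : ∀ {x y : W} {i i' : Fin 3}, x ≠ y → (x, i) ≠ (y, i') := fun h h' =>
    h (congrArg Prod.fst h')
  have hjk : j ≠ k := by
    rintro rfl
    exact ne2 hQ.symm (hC4.eq_of_adj (ne1 hab) (hK P a ha) (hK P b hb) h1 h2)
  have h5 : ¬ K.Adj (P, a) (Q', k) := fun h =>
    ne1 hjk (hC4.eq_of_adj (ne2 hQ.symm) h1 (hK Q' j hj).symm h (hK Q' k hk).symm)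
  have h6 : ¬ K.Adj (P, b) (Q', j) := fun h =>
    ne1 hjk (hC4.eq_of_adj (ne2 hQ.symm) h (hK Q' j hj).symm h2 (hK Q' k hk).symm)
  have hclosed : ∀ p q : W × Fin 3, K.Adj p q → p.1 = P ∨ p.1 = Q' → q.1 = P ∨ q.1 = Q' := by
    rintro ⟨x, i⟩ ⟨y, i'⟩ hadj (rfl | rfl)
    · by_cases hy : y = x
      · exact Or.inl hy
      · right
        by_cases hia : i = a
        · subst hia; exact hends hy hQ hab hadj h2
        · exact hends hy hQ hia hadj h1
    · by_cases hy : y = x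
      · exact Or.inr hy
      · left
        by_cases hij : i = j
        · subst hij; exact hends hy hQ.symm hjk hadj h2.symm
        · exact hends hy hQ.symm hij hadj h1.symm
  have hW : ∀ w, w = P ∨ w = Q' := by
    have key : ∀ p q : W × Fin 3, K.Reachable p q → p.1 = P ∨ p.1 = Q' → q.1 = P ∨ q.1 = Q' := by
      rintro p q ⟨w⟩
      induction w with
      | nil => exact id
      | cons hadj _ ih => exact fun hp => ih (hclosed _ _ hadj hp)
    exact fun w => key (P, 0) (w, 0) (hconn.preconnected _ _) (Or.inl rfl)
  refine Or.inl (hK.nonempty_iso_cycleGraph_six hQ hW ha hb hab hj hk hjk h1 h2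
    (fun h => ?_) (fun h => ?_) h5 h6 (fun i => hmid hQ) (fun i => hmid hQ.symm))
  · exact hno (hK.small_of_chord hQ ha hb hab hj hk hjk h1 h2 h)
  · exact hno (hK.small_of_chord hQ.symm hj hk hjk ha hb hab h1.symm h2.symm h)

end Extremal

/-! ### The upper bound and its extremal graphs -/

/-- An admissible graph whose vertices are all leaves or centers of paths `P₃` is a disjoint union
of such paths. -/
theorem exists_hasP3Packing {F G : SimpleGraph V} (hF : IsAdmissible F) (hFG : F ≤ G)
    (hall : ∀ v, IsLeaf F v ∨ IsP3Center F v) :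
    ∃ (W : Type u) (K : SimpleGraph (W × Fin 3)), HasP3Packing K ∧ Nonempty (K ≃g G) := by
  have h : ∀ s : {s // IsP3Center F s}, ∃ a b, a ≠ b ∧ IsLeafAt F a s ∧ IsLeafAt F b s :=
    fun s => s.2
  choose a b hab ha hb using h
  have hsl : ∀ s : {s // IsP3Center F s}, ¬ IsLeaf F s := fun s => (s.2.isNeedy hF).1.not_isLeaf hF
  have hnl : ∀ (s : {s // IsP3Center F s}) {v c : V}, IsLeafAt F v c → v ≠ s := by
    rintro s v c h rfl
    exact hsl s ⟨c, h⟩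
  have heq : ∀ {v : V} {s t : {s // IsP3Center F s}}, IsLeafAt F v s → IsLeafAt F v t → s = t :=
    fun h h' => Subtype.ext (h'.2 _ h.1)
  set f : {s // IsP3Center F s} × Fin 3 → V := fun p => ![a p.1, p.1, b p.1] p.2 with hf
  have hfb : Function.Bijective f := by
    constructor
    · rintro ⟨s, i⟩ ⟨t, j⟩ hst
      have key : s = t := by
        fin_cases i <;> fin_cases j <;> simp [hf] at hst
        · exact heq (ha s) (hst ▸ ha t)
        · exact absurd hst (hnl t (ha s))
        · exact heq (ha s) (hst ▸ hb t)
        · exact absurd hst.symm (hnl s (ha t))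
        · exact Subtype.ext hst
        · exact absurd hst.symm (hnl s (hb t))
        · exact heq (hb s) (hst ▸ ha t)
        · exact absurd hst (hnl t (hb s))
        · exact heq (hb s) (hst ▸ hb t)
      subst key
      have h1 := hnl s (ha s)
      have h2 := hnl s (hb s)
      have h3 := hab s
      fin_cases i <;> fin_cases j <;> simp [hf, h1, h2, h3, h1.symm, h2.symm, h3.symm] at hst ⊢
    · intro v
      by_cases hv : IsP3Center F v
      · exact ⟨(⟨v, hv⟩, 1), rfl⟩
      · obtain ⟨c, hc⟩ := (hall v).resolve_right hv
        have hcc : IsP3Center F c := (hall c).resolve_left (IsSupport.not_isLeaf hF ⟨v, hc⟩)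
        rcases hF.eq_or_eq _ _ _ (hab ⟨c, hcc⟩) (ha _) (hb _) v hc.1.symm with h | h
        · exact ⟨(⟨c, hcc⟩, 0), h.symm⟩
        · exact ⟨(⟨c, hcc⟩, 2), h.symm⟩
  refine ⟨_, G.comap f, ?_, ⟨⟨Equiv.ofBijective f hfb, Iff.rfl⟩⟩⟩
  intro s i hi
  fin_cases i
  · exact hFG (ha s).1
  · exact absurd rfl hi
  · exact hFG (hb s).1

theorem IsC6OrTwoCorona.of_iso {V' : Type u} {G : SimpleGraph V} {G' : SimpleGraph V'}
    (e : G ≃g G') (h : IsC6OrTwoCorona G') : IsC6OrTwoCorona G := by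
  rcases h with ⟨⟨e'⟩⟩ | ⟨W, H, h1, h2, h3, ⟨e'⟩⟩
  · exact Or.inl ⟨e'.comp e⟩
  · exact Or.inr ⟨W, H, h1, h2, h3, ⟨e'.comp e⟩⟩

theorem exists_isSparseTD_card_le [Fintype V] {G : SimpleGraph V} (htf : IsTwinFree G)
    (hiso : NoIsolated G) :
    ∃ D : Finset V, IsSparseTD G (D : Set V) ∧ 3 * D.card ≤ 2 * Fintype.card V := by
  obtain ⟨F, hFG, hF⟩ :=
    exists_minimal_le_of_wellFoundedLT IsAdmissible G (isAdmissible_of_isTwinFree htf hiso)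
  obtain ⟨D, hD, hc⟩ := (hasSmallSparseTD_or_of_minimal hF).1
  exact ⟨D, hD.mono hFG, hc⟩

theorem isC6OrTwoCorona_of_not_hasSmallSparseTD [Fintype V] {G : SimpleGraph V}
    (htf : IsTwinFree G) (hiso : NoIsolated G) (hC4 : NoFourCycle G) (hconn : G.Connected)
    (hno : ¬ HasSmallSparseTD G) : IsC6OrTwoCorona G := by
  classical
  obtain ⟨F, hFG, hF⟩ :=
    exists_minimal_le_of_wellFoundedLT IsAdmissible G (isAdmissible_of_isTwinFree htf hiso)
  have hall := (hasSmallSparseTD_or_of_minimal hF).2.resolve_left fun h => hno (h.mono hFG)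
  obtain ⟨W, K, hK, ⟨e⟩⟩ := exists_hasP3Packing hF.1 hFG hall
  have : Finite W :=
    Finite.of_injective (fun w => e (w, 0)) fun a b h => congrArg Prod.fst (e.injective h)
  have := Fintype.ofFinite W
  exact IsC6OrTwoCorona.of_iso e.symm <| hK.isC6OrTwoCorona (htf.of_iso e)
    (noFourCycle_of_hom e.toHom e.injective hC4) (e.connected_iff.2 hconn)
    fun h => hno (h.of_iso e)

/-! ### The lower bound for the extremal graphs -/

/-- Every total dominating set of `G` contains at least two thirds of the vertices. -/
def HasTwoThirdsBound [Fintype V] (G : SimpleGraph V) : Prop :=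
  ∀ D : Finset V, IsTotalDominating G (D : Set V) → 2 * Fintype.card V ≤ 3 * D.card

theorem HasTwoThirdsBound.of_iso {W : Type*} [Fintype V] [Fintype W] {G : SimpleGraph V}
    {H : SimpleGraph W} (e : G ≃g H) (h : HasTwoThirdsBound H) : HasTwoThirdsBound G := by
  intro D hD
  have := h (D.map e.toEquiv.toEmbedding) fun w => by
    obtain ⟨v, rfl⟩ := e.surjective w
    obtain ⟨d, hd, hdD⟩ := hD v
    exact ⟨e d, e.map_adj_iff.2 hd, by simpa using hdD⟩
  rwa [Finset.card_map, ← Fintype.card_congr e.toEquiv] at this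

theorem hasTwoThirdsBound_cycleGraph_six : HasTwoThirdsBound (cycleGraph 6) := by
  have key : ∀ D : Finset (Fin 6), (∀ v : Fin 6, ∃ d ∈ D, v - d = 1 ∨ d - v = 1) →
      2 * 6 ≤ 3 * D.card := by decide
  intro D hD
  rw [Fintype.card_fin]
  refine key D fun v => ?_
  obtain ⟨d, hvd, hd⟩ := hD v
  exact ⟨d, hd, cycleGraph_adj.1 hvd⟩

/-- A total dominating set of a 2-corona contains the middle vertex of each attached path, because
of the leaf, and one of the two neighbors of this middle vertex. -/
theorem hasTwoThirdsBound_twoCorona {W : Type u} [Fintype W] (H : SimpleGraph W) :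
    HasTwoThirdsBound (twoCorona H) := by
  classical
  intro D hD
  have h1 : ∀ w, (w, (1 : Fin 3)) ∈ D := by
    intro w
    obtain ⟨⟨x, j⟩, h, hx⟩ := hD (w, 2)
    have : (x, j) = (w, 1) := by
      simp [twoCorona] at h
      simp [h.1, h.2]
    exact this ▸ hx
  have h2 : ∀ w, ∃ j : Fin 3, j ≠ 1 ∧ (w, j) ∈ D := by
    intro w
    obtain ⟨⟨x, j⟩, h, hx⟩ := hD (w, 1)
    simp [twoCorona] at h
    obtain ⟨rfl, hj⟩ := h
    exact ⟨j, by omega, hx⟩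
  choose j hj hjD using h2
  have hsub : Finset.univ.image (fun w => (w, (1 : Fin 3))) ∪ Finset.univ.image (fun w => (w, j w))
      ⊆ D := by
    intro p hp
    simp only [Finset.mem_union, Finset.mem_image, Finset.mem_univ, true_and] at hp
    rcases hp with ⟨w, rfl⟩ | ⟨w, rfl⟩
    exacts [h1 w, hjD w]
  have := Finset.card_le_card hsub
  rw [Finset.card_union_of_disjoint, Finset.card_image_of_injective, Finset.card_image_of_injective,
    Finset.card_univ] at this
  · rw [Fintype.card_prod, Fintype.card_fin]
    omega
  · exact fun a b h => congrArg Prod.fst h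
  · exact fun a b h => congrArg Prod.fst h
  · rw [Finset.disjoint_left]
    intro p hp hq
    simp only [Finset.mem_image, Finset.mem_univ, true_and] at hp hq
    obtain ⟨w, rfl⟩ := hp
    obtain ⟨w', h⟩ := hq
    exact hj w' (congrArg Prod.snd h)

theorem IsC6OrTwoCorona.hasTwoThirdsBound [Fintype V] {G : SimpleGraph V}
    (h : IsC6OrTwoCorona G) : HasTwoThirdsBound G := by
  classical
  rcases h with ⟨⟨e⟩⟩ | ⟨W, H, -, -, -, ⟨e⟩⟩
  · exact hasTwoThirdsBound_cycleGraph_six.of_iso e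
  · have : Finite W := Finite.of_injective (fun w => e.symm (w, 0)) fun a b h =>
      congrArg Prod.fst (e.symm.injective h)
    have := Fintype.ofFinite W
    exact (hasTwoThirdsBound_twoCorona H).of_iso e

theorem hasTwoThirdsBound_of_components [Fintype V] {G : SimpleGraph V}
    (h : ∀ (C : G.ConnectedComponent) [Fintype C], HasTwoThirdsBound C.toSimpleGraph) :
    HasTwoThirdsBound G := by
  classical
  intro D hD
  have hC : ∀ C : G.ConnectedComponent,
      2 * (Finset.univ.filter fun v => G.connectedComponentMk v = C).card ≤
        3 * (D.filter fun v => G.connectedComponentMk v = C).card := by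
    intro C
    have h1 := h C (D.subtype (· ∈ C)) fun v => by
      obtain ⟨d, hd, hdD⟩ := hD v
      have hdC : d ∈ C := by
        have hv : G.connectedComponentMk v = C := v.2
        have := ConnectedComponent.connectedComponentMk_eq_of_adj hd
        exact (this.symm.trans hv : _)
      exact ⟨⟨d, hdC⟩, hd, by simpa using hdD⟩
    rw [Finset.card_subtype, Fintype.card_subtype] at h1
    exact h1
  have e1 := Finset.card_eq_sum_card_fiberwise (s := (Finset.univ : Finset V))
    (t := (Finset.univ : Finset G.ConnectedComponent)) (f := G.connectedComponentMk)
    (fun _ _ => Finset.mem_univ _)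
  have e2 := Finset.card_eq_sum_card_fiberwise (s := D)
    (t := (Finset.univ : Finset G.ConnectedComponent)) (f := G.connectedComponentMk)
    (fun _ _ => Finset.mem_univ _)
  rw [← Finset.card_univ, e1, e2, Finset.mul_sum, Finset.mul_sum]
  exact Finset.sum_le_sum fun C _ => hC C

/-! ### Restriction to unions of components -/

theorem IsTwinFree.induce {G : SimpleGraph V} (htf : IsTwinFree G) {A : Set V}
    (hA : ∀ u v, G.Adj u v → u ∈ A → v ∈ A) : IsTwinFree (G.induce A) := by
  refine isTwinFree_of_forall (fun u v h => Subtype.ext (htf.open_eq fun w => ?_))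
    (fun u v h => Subtype.ext (htf.closed_eq fun w => ?_))
  · by_cases hw : w ∈ A
    · exact h ⟨w, hw⟩
    · exact iff_of_false (fun h => hw (hA _ _ h u.2)) (fun h => hw (hA _ _ h v.2))
  · by_cases hw : w ∈ A
    · simpa [Subtype.ext_iff] using h ⟨w, hw⟩
    · refine iff_of_false ?_ ?_
      · rintro (rfl | h)
        exacts [hw u.2, hw (hA _ _ h u.2)]
      · rintro (rfl | h)
        exacts [hw v.2, hw (hA _ _ h v.2)]

theorem NoIsolated.induce {G : SimpleGraph V} (hiso : NoIsolated G) {A : Set V}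
    (hA : ∀ u v, G.Adj u v → u ∈ A → v ∈ A) : NoIsolated (G.induce A) := by
  rintro ⟨v, hv⟩
  obtain ⟨w, hw⟩ := hiso v
  exact ⟨⟨w, hA v w hw hv⟩, hw⟩

/-- A small sparse total dominating set of a union of components extends to the whole graph. -/
theorem HasSmallSparseTD.of_induce [Fintype V] {G : SimpleGraph V} (htf : IsTwinFree G)
    (hiso : NoIsolated G) {A : Set V} {_ : Fintype A} (hA : ∀ u v, G.Adj u v → u ∈ A → v ∈ A)
    (h : HasSmallSparseTD (G.induce A)) : HasSmallSparseTD G := by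
  classical
  have hA' : ∀ u v, G.Adj u v → u ∈ Aᶜ → v ∈ Aᶜ := fun u v h hu hv => hu (hA v u h.symm hv)
  obtain ⟨D₁, hD₁, hc₁⟩ := h
  obtain ⟨D₂, hD₂, hc₂⟩ := exists_isSparseTD_card_le (htf.induce hA') (hiso.induce hA')
  obtain ⟨D, hD, hc⟩ := exists_isSparseTD_union G A hD₁ hD₂
  refine ⟨D, hD, ?_⟩
  have : Fintype.card A + Fintype.card (Aᶜ : Set V) = Fintype.card V :=
    Fintype.card_congr (Equiv.Set.sumCompl A) ▸ (Fintype.card_sum).symm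
  omega

theorem locTotDomNumber_le {G : SimpleGraph V} {D : Finset V} (h : IsLTD G (D : Set V)) :
    locTotDomNumber G ≤ D.card :=
  Nat.sInf_le ⟨D, h, rfl⟩

theorem three_mul_locTotDomNumber_le [Fintype V] {G : SimpleGraph V} (htf : IsTwinFree G)
    (hiso : NoIsolated G) (hC4 : NoFourCycle G) :
    3 * locTotDomNumber G ≤ 2 * Fintype.card V := by
  obtain ⟨D, hD, hc⟩ := exists_isSparseTD_card_le htf hiso
  have := locTotDomNumber_le (hD.isLTD hC4)
  omega

theorem not_hasSmallSparseTD_of_eq [Fintype V] {G : SimpleGraph V} (hC4 : NoFourCycle G)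
    (heq : 3 * locTotDomNumber G = 2 * Fintype.card V) : ¬ HasSmallSparseTD G := by
  rintro ⟨D, hD, hc⟩
  have := locTotDomNumber_le (hD.isLTD hC4)
  omega

theorem HasTwoThirdsBound.le_locTotDomNumber [Fintype V] {G : SimpleGraph V}
    (hiso : NoIsolated G) (h : HasTwoThirdsBound G) :
    2 * Fintype.card V ≤ 3 * locTotDomNumber G := by
  obtain ⟨D, hD, hc⟩ := exists_isLTD_card_eq hiso
  rw [← hc]
  exact h D hD.1

end LocTotDom

theorem theorem6 {V : Type*} [Fintype V] (G : SimpleGraph V)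
    (htf : LocTotDom.IsTwinFree G) (hiso : LocTotDom.NoIsolated G)
    (hC4 : LocTotDom.NoFourCycle G) :
    (LocTotDom.locTotDomNumber G : ℝ) ≤ 2 / 3 * (Fintype.card V : ℝ) ∧
    (G.Connected →
      ((LocTotDom.locTotDomNumber G : ℝ) = 2 / 3 * (Fintype.card V : ℝ) ↔
        LocTotDom.IsC6OrTwoCorona G)) ∧
    ((LocTotDom.locTotDomNumber G : ℝ) = 2 / 3 * (Fintype.card V : ℝ) ↔
      ∀ C : G.ConnectedComponent, LocTotDom.IsC6OrTwoCorona C.toSimpleGraph) := by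
  classical
  have hle := LocTotDom.three_mul_locTotDomNumber_le htf hiso hC4
  have hcast : (LocTotDom.locTotDomNumber G : ℝ) = 2 / 3 * (Fintype.card V : ℝ) ↔
      3 * LocTotDom.locTotDomNumber G = 2 * Fintype.card V := by
    rw [← @Nat.cast_inj ℝ]
    push_cast
    constructor <;> intro h <;> linarith
  rw [hcast]
  refine ⟨?_, fun hconn => ⟨fun heq => ?_, fun h => ?_⟩, fun heq C => ?_, fun h => ?_⟩
  · have : (3 * LocTotDom.locTotDomNumber G : ℝ) ≤ 2 * Fintype.card V := by exact_mod_cast hle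
    linarith
  · exact LocTotDom.isC6OrTwoCorona_of_not_hasSmallSparseTD htf hiso hC4 hconn
      (LocTotDom.not_hasSmallSparseTD_of_eq hC4 heq)
  · exact le_antisymm hle (h.hasTwoThirdsBound.le_locTotDomNumber hiso)
  · have hA : ∀ u v, G.Adj u v → u ∈ C.supp → v ∈ C.supp := fun u v huv hu =>
      C.mem_supp_of_adj_mem_supp hu huv
    refine LocTotDom.isC6OrTwoCorona_of_not_hasSmallSparseTD (htf.induce hA) (hiso.induce hA)
      (LocTotDom.noFourCycle_of_hom C.toSimpleGraph_hom Subtype.val_injective hC4)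
      C.connected_toSimpleGraph fun hs => ?_
    exact LocTotDom.not_hasSmallSparseTD_of_eq hC4 heq
      (LocTotDom.HasSmallSparseTD.of_induce htf hiso hA hs)
  · refine le_antisymm hle (LocTotDom.HasTwoThirdsBound.le_locTotDomNumber hiso ?_)
    exact LocTotDom.hasTwoThirdsBound_of_components fun C _ => (h C).hasTwoThirdsBound
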